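/- Theorem. Let $\Delta=\{(x_1,x_2): x_1,x_2>0,\ x_1+x_2<\pi/2\}$. A point $X=(x_1,x_2)\in\Delta$ represents the obtuse triangle (unique up to similarity) with sides labelled $1,2,3$ whose angles opposite sides $1$ and $2$ are $x_1$ and $x_2$ radians. For a nonempty finite word $W$ in the digits $1,2,3$, let the orbit tile $O(W)\subset\Delta$ be the set of all $X$ such that the triangle represented by $X$ has a periodic billiard path which closes up after as many bounces as $W$ has digits, and which successively hits the sides (at interior points) in the order given by the digits of $W$. For integers $n\ge 3$ and $k\ge 0$ put $a=23$, $b=13$ (two-digit words; powers denote repetition and juxtaposition denotes concatenation) and let $W_{nk}$ be the word $$W_{nk}=(a^{n-1}b^{n-1})^{k+1}\,a^{n-1}b^{n-2}\,1\;\cdot\;a^{n}(b^{n-1}a^{n-1})^{k}\,b^{n-1}a^{n-2}\,2\;\cdot\;b^{n}(a^{n-1}b^{n-1})^{k}\,a^{n-1}\,2\;\cdot\;(b^{n-1}a^{n-1})^{k+1}\,b^{n-1}\,1,$$ of length $24n-20+16(n-1)k$. Let $V_n=(\frac{\pi}{2n},\frac{\pi}{2n})$ and, for $\epsilon>0$,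 $$N_{++}(n,\epsilon)=\{V_n+v:\ v\in\mathbb{R}^2,\ |v|<\epsilon,\ v_1>0,\ v_2>0\}.$$ Then for each $n\ge 3$ there is some $\epsilon=\epsilon_n>0$ such that $$\overline{N}_{++}(n,\epsilon)\setminus\{V_n\}\ \subset\ \bigcup_{k=0}^{\infty}O(W_{nk}),$$ where $\overline{N}_{++}(n,\epsilon)$ is the closure of $N_{++}(n,\epsilon)$ in $\mathbb{R}^2$. -/

import Mathlib

open scoped EuclideanGeometry

/-- The Euclidean plane. It serves both as the plane of the triangle and as parameter plane;
the two coordinates of a parameter point `X` are `X 0` and `X 1`. -/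
abbrev Plane : Type := EuclideanSpace ℝ (Fin 2)

/-- The parameter space of obtuse triangles: the two small angles are `X 0` and `X 1`. -/
def paramSpace : Set Plane := {X | 0 < X 0 ∧ 0 < X 1 ∧ X 0 + X 1 < Real.pi / 2}

/-- The triangle `T` has the shape given by the parameter point `X`: the angle opposite side `1`
(at vertex `1`) is `X 0`, the angle opposite side `2` (at vertex `2`) is `X 1`. Vertices and sides
are indexed by `1, 2, 3 : Fin 3`, where the numeral `3` denotes the residue `0` modulo `3`. -/
def HasShape (T : Affine.Triangle ℝ Plane) (X : Plane) : Prop :=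
  ∠ (T.points 2) (T.points 1) (T.points 3) = X 0 ∧
  ∠ (T.points 1) (T.points 2) (T.points 3) = X 1

/-- The `d`-th side (opposite vertex `d`), without its two endpoints. -/
def openSide (T : Affine.Triangle ℝ Plane) (d : Fin 3) : Set Plane :=
  openSegment ℝ (T.points (d + 1)) (T.points (d + 2))

/-- Linear reflection of vectors in the direction of the `d`-th side. -/
noncomputable def sideReflection (T : Affine.Triangle ℝ Plane) (d : Fin 3) :
    Plane ≃ₗᵢ[ℝ] Plane :=
  (Submodule.span ℝ {T.points (d + 2) - T.points (d + 1)}).reflection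

/-- The `i`-th digit (`i = 0, 1, 2, …`) of the infinite periodic word with period `W`. -/
def digit (W : List (Fin 3)) (i : ℕ) : Fin 3 := W.getD (i % W.length) 3

/-- `p 0, p 1, p 2, …` are the successive bounce points of a periodic billiard path in `T` which
closes up after `W.length` bounces and whose successive sides are given by the word `W`:
each bounce point is an interior point of the prescribed side, and at each bounce the
direction of motion is reflected in that side. -/
structure IsPeriodicBilliardPath (T : Affine.Triangle ℝ Plane) (W : List (Fin 3))
    (p : ℕ → Plane) : Prop where
  periodic : ∀ i, p (i + W.length) = p i
  mem_side : ∀ i, p i ∈ openSide T (digit W i)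
  moves : ∀ i, p i ≠ p (i + 1)
  reflects : ∀ i, SameRay ℝ (sideReflection T (digit W (i + 1)) (p (i + 1) - p i))
    (p (i + 2) - p (i + 1))

/-- The orbit tile `O(W)`: the parameter points `X` such that `W` describes the combinatorics of
a periodic billiard path in the triangle of shape `X`. -/
def orbitTile (W : List (Fin 3)) : Set Plane :=
  {X | X ∈ paramSpace ∧ W ≠ [] ∧ ∃ T : Affine.Triangle ℝ Plane, HasShape T X ∧
    ∃ p : ℕ → Plane, IsPeriodicBilliardPath T W p}

/-- The word `u` repeated `k` times. -/
def wordPow (u : List (Fin 3)) (k : ℕ) : List (Fin 3) := (List.replicate k u).flatten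

/-- The word `W_{n,k}` (for `n ≥ 3`, `k ≥ 0`), with `a = 23`, `b = 13`. It is the word whose
squarepath is the closed rectilinear path starting at `(0,1)` and consisting, with `M = 2n - 2`, of
`(E M, S M)` `k + 2` times; `W (M + 2)`; `(N M, W M)` `k + 1` times; `S (M + 2)`;
`(E M, S M)` `k` times; `E (M + 2)`; `(N M, W M)` `k + 1` times; `N (M + 2)`.
An edge of length `2m` gives `m` digits `2` (if horizontal) or `1` (if vertical), separated by
digits `3`; two consecutive edges are separated by a further digit `3` exactly when the turn
between them is of type E-S, S-E, W-N or N-W. -/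
def tileWord (n k : ℕ) : List (Fin 3) :=
  let a : List (Fin 3) := [2, 3]
  let b : List (Fin 3) := [1, 3]
  -- Edges (E, S) repeated `k + 2` times, ending at an S-W turn without digit `3`.
  wordPow (wordPow a (n - 1) ++ wordPow b (n - 1)) (k + 1)
    ++ wordPow a (n - 1) ++ wordPow b (n - 2) ++ [1]
  -- A longer edge W, then (N, W) repeated `k + 1` times, ending at a W-S turn.
  ++ wordPow a n ++ wordPow (wordPow b (n - 1) ++ wordPow a (n - 1)) k
    ++ wordPow b (n - 1) ++ wordPow a (n - 2) ++ [2]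
  -- A longer edge S, then (E, S) repeated `k` times, then a longer edge E, ending at an E-N turn.
  ++ wordPow b n ++ wordPow (wordPow a (n - 1) ++ wordPow b (n - 1)) k
    ++ wordPow a (n - 1) ++ [2]
  -- Edges (N, W) repeated `k + 1` times, then a longer edge N, ending at an N-E turn.
  ++ wordPow (wordPow b (n - 1) ++ wordPow a (n - 1)) (k + 1)
    ++ wordPow b (n - 1) ++ [1]

/-- The Veech point `V_n = (π/2n, π/2n)`. -/
noncomputable def veechPoint (n : ℕ) : Plane := !₂[Real.pi / (2 * n), Real.pi / (2 * n)]

/-- `N_{++}(n, ε)`: the part of the `ε`-ball around `V_n` in the open `(+,+)` quadrant at `V_n`. -/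
def quadrantNhd (n : ℕ) (ε : ℝ) : Set Plane :=
  {X | ∃ v : Plane, v ∈ Metric.ball (0 : Plane) ε ∧ 0 < v 0 ∧ 0 < v 1 ∧ X = veechPoint n + v}

/-!
A billiard path in a triangle is a straight line in the plane into which the triangle is unfolded
by successive reflections. Instead of reflecting the triangle in the side that is hit, the line of
flight is reflected here, so that the triangle stays in a standard position (`Sight`, `cross`).
A word occurs as the periodic sequence of sides hit by a path if there is a line that crosses the
sides in this order and is mapped to itself after one period (`mem_orbitTile_of_follows`). Every
crossing is a condition on the signs of the heights of two vertices above the line.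

Write `N = n - 1`. A factor `(23)^m` of the word unfolds into a fan of triangles around the vertex
`1`, a factor `(13)^m` into a fan around the vertex `2`. Where fans around the two vertices
alternate, the long sides shared by consecutive fans form a zigzag, whose upper vertices are the
centres of the fans of one kind and whose lower vertices are the centres of the others. Up to
rotation, `tileWord n k` consists of four such zigzags, which are joined at four corners
(`tileWord_rotate`). Along a zigzag the vertices descend on both sides of the line of flight, so
that only its two ends matter. Therefore the word is realized as soon as the four vertices
between consecutive zigzags lie on the correct side of the line, at a distance smaller than the
height spanned by the short side issuing from them, and the total gain in height vanishes
(`mem_orbitTile_of_zigRise`).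

Let `x₁ = γ + v₁` and `x₂ = γ + v₂` with `γ = π / (2 * n)`, and let `S = v₁ + v₂`. The slopes of the
ascending sides of a zigzag form an arithmetic progression with difference
`± 2 * N * (v₁ - v₂)` near `γ`. This gives first order expansions of the four gains in height in
terms of the mean slope (`abs_zigRises_sub_le`); by the intermediate value theorem some mean slope
makes their sum vanish (`exists_slope`). The remaining inequalities hold to first order in
`δ = 1 / k`, with a margin comparable to `δ`, if `k ^ 2 * S` is close to `tan γ * N / (2 * n ^ 2)`
(`Regime.mem_orbitTile`). Near the Veech point `S` is small, so `k` can be chosen as the integer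
part of the square root of `tan γ * N / (2 * n ^ 2 * S)`; it is large, and the second order error
terms are dominated by the margin. The choice depends only on `S`, not on the ratio of `v₁` and
`v₂`, which is why the boundary of the quadrant is covered as well.
-/

/-! ### The line of flight seen from the triangle -/

/-- Length of side `1` of the triangle with angles `x₁`, `x₂` and longest side of length `1`. -/
noncomputable def legOne (x₁ x₂ : ℝ) : ℝ := Real.sin x₁ / Real.sin (x₁ + x₂)

/-- Length of side `2` of the triangle with angles `x₁`, `x₂` and longest side of length `1`. -/
noncomputable def legTwo (x₁ x₂ : ℝ) : ℝ := Real.sin x₂ / Real.sin (x₁ + x₂)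

/-- The vertices of the positively oriented triangle with angles `x₁`, `x₂` at the vertices
`1 = (0, 0)` and `2 = (1, 0)`. The vertex `3` has index `0 : Fin 3`. -/
noncomputable def vertexAt (x₁ x₂ : ℝ) : Fin 3 → Plane :=
  ![!₂[legTwo x₁ x₂ * Real.cos x₁, legTwo x₁ x₂ * Real.sin x₁], !₂[0, 0], !₂[1, 0]]

/-- A directed line in the plane of the triangle, the line of flight. The pair `(θ, y)` stands for
the zero set of the function `height (θ, y)`, directed by `heading (θ, y)`. -/
abbrev Sight : Type := Real.Angle × ℝ

/-- Signed distance of a point from the line of flight, positive on its left. -/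
noncomputable def height (s : Sight) (p : Plane) : ℝ := s.1.sin * p 0 + s.1.cos * p 1 + s.2

/-- Unit vector in the direction of flight. -/
noncomputable def heading (s : Sight) : Plane := !₂[s.1.cos, -s.1.sin]

/-- The line of flight after the bounce off side `d`: its mirror image in this side. Since a
reflection exchanges left and right, the heights of the two ends of the side change sign. -/
noncomputable def cross (x₁ x₂ : ℝ) (s : Sight) : Fin 3 → Sight :=
  ![(-s.1, -s.2),
    (((2 * x₂ : ℝ) : Real.Angle) - s.1,
      -s.2 - s.1.sin - (((2 * x₂ : ℝ) : Real.Angle) - s.1).sin),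
    (-s.1 - ((2 * x₁ : ℝ) : Real.Angle), -s.2)]

theorem leg_sum_cos {x₁ x₂ : ℝ} (h : Real.sin (x₁ + x₂) ≠ 0) :
    legTwo x₁ x₂ * Real.cos x₁ + legOne x₁ x₂ * Real.cos x₂ = 1 := by
  unfold legOne legTwo
  field_simp
  rw [Real.sin_add]; ring

theorem leg_sin {x₁ x₂ : ℝ} :
    legTwo x₁ x₂ * Real.sin x₁ = legOne x₁ x₂ * Real.sin x₂ := by
  unfold legOne legTwo
  ring

/-- Reflection in a line of direction `α` takes the direction `-θ` to `2 * α + θ`. -/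
theorem reflection_span_polar (r α θ : ℝ) (hr : r ≠ 0) :
    (Submodule.span ℝ {r • (!₂[Real.cos α, Real.sin α] : Plane)}).reflection
      !₂[Real.cos θ, -Real.sin θ] = !₂[Real.cos (2 * α + θ), Real.sin (2 * α + θ)] := by
  have h1 : Submodule.span ℝ {r • (!₂[Real.cos α, Real.sin α] : Plane)}
      = Submodule.span ℝ {(!₂[Real.cos α, Real.sin α] : Plane)} :=
    Submodule.span_singleton_smul_eq (IsUnit.mk0 r hr) _
  have h2 : ‖(!₂[Real.cos α, Real.sin α] : Plane)‖ ^ 2 = 1 := by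
    rw [EuclideanSpace.norm_sq_eq]
    simp [Fin.sum_univ_two]
  have hc := Real.sin_sq_add_cos_sq α
  have key : ∀ K : Submodule ℝ Plane, K = Submodule.span ℝ {(!₂[Real.cos α, Real.sin α] : Plane)} →
      ∀ [K.HasOrthogonalProjection], K.reflection
      !₂[Real.cos θ, -Real.sin θ] = !₂[Real.cos (2 * α + θ), Real.sin (2 * α + θ)] := by
    rintro K rfl _
    rw [Submodule.reflection_singleton_apply]
    ext i
    rw [Real.cos_add, Real.sin_add, Real.cos_two_mul, Real.sin_two_mul]
    fin_cases i <;>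
    simp [PiLp.inner_apply, Fin.sum_univ_two, h2]
    · ring
    · linear_combination (-2 * Real.sin θ) * hc
  exact key _ h1

theorem height_cross_ends (x₁ x₂ : ℝ) (h : Real.sin (x₁ + x₂) ≠ 0) (s : Sight) (d : Fin 3) :
    height (cross x₁ x₂ s d) (vertexAt x₁ x₂ (d + 1)) = -height s (vertexAt x₁ x₂ (d + 1)) ∧
    height (cross x₁ x₂ s d) (vertexAt x₁ x₂ (d + 2)) = -height s (vertexAt x₁ x₂ (d + 2)) := by
  obtain ⟨θ, y⟩ := s
  induction θ using Real.Angle.induction_on with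
  | _ θ =>
  have e1 := leg_sum_cos h
  have e2 := leg_sin (x₁ := x₁) (x₂ := x₂)
  have c1 := Real.sin_sq_add_cos_sq x₁
  have c2 := Real.sin_sq_add_cos_sq x₂
  have e3 : legTwo x₁ x₂ * Real.cos x₁ = 1 - legOne x₁ x₂ * Real.cos x₂ := by linarith
  fin_cases d
  · simp [height, cross, vertexAt]
    ring
  · simp [height, cross, vertexAt]
    rw [e3, e2]
    simp only [← Real.Angle.coe_sub, Real.Angle.sin_coe, Real.Angle.cos_coe,
      Real.sin_sub, Real.cos_sub, Real.sin_two_mul, Real.cos_two_mul]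
    constructor
    · ring
    · linear_combination (2 * Real.cos x₂ * Real.sin θ * legOne x₁ x₂) * c2
  · simp [height, cross, vertexAt]
    simp only [← Real.Angle.coe_neg, ← Real.Angle.coe_sub, Real.Angle.sin_coe, Real.Angle.cos_coe,
      Real.sin_sub, Real.cos_sub, Real.sin_two_mul, Real.cos_two_mul, Real.sin_neg, Real.cos_neg]
    linear_combination (-2 * Real.sin θ * Real.cos x₁ * legTwo x₁ x₂) * c1

theorem sideReflection_heading {x₁ x₂ : ℝ} (h : Real.sin (x₁ + x₂) ≠ 0) (h₁ : Real.sin x₁ ≠ 0)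
    (h₂ : Real.sin x₂ ≠ 0) (T : Affine.Triangle ℝ Plane) (hT : T.points = vertexAt x₁ x₂)
    (s : Sight) (d : Fin 3) :
    sideReflection T d (heading s) = heading (cross x₁ x₂ s d) := by
  obtain ⟨θ, y⟩ := s
  induction θ using Real.Angle.induction_on with
  | _ θ =>
  have l1 : legOne x₁ x₂ ≠ 0 := div_ne_zero h₁ h
  have l2 : -legTwo x₁ x₂ ≠ 0 := neg_ne_zero.mpr (div_ne_zero h₂ h)
  have e1 := leg_sum_cos h
  have e2 := leg_sin (x₁ := x₁) (x₂ := x₂)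
  have key : ∀ (r α : ℝ), r ≠ 0 → T.points (d + 2) - T.points (d + 1)
      = r • (!₂[Real.cos α, Real.sin α] : Plane) →
      sideReflection T d (heading ((θ : Real.Angle), y))
        = !₂[Real.cos (2 * α + θ), Real.sin (2 * α + θ)] := by
    intro r α hr hv
    have := reflection_span_polar r α θ hr
    unfold sideReflection heading
    simp only [hv, Real.Angle.cos_coe, Real.Angle.sin_coe]
    exact this
  rw [hT] at key
  fin_cases d
  · rw [key 1 0 one_ne_zero]
    · simp [heading, cross]
    · ext i; fin_cases i <;> simp [vertexAt]
  · rw [key _ (Real.pi - x₂) l1]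
    · simp only [heading, cross]
      simp only [← Real.Angle.coe_sub, Real.Angle.sin_coe, Real.Angle.cos_coe, Fin.mk_one,
        Matrix.cons_val_one, Matrix.cons_val_zero]
      rw [show 2 * (Real.pi - x₂) + θ = 2 * Real.pi - (2 * x₂ - θ) by ring, Real.cos_two_pi_sub,
        Real.sin_two_pi_sub]
    · ext i; fin_cases i <;> simp [vertexAt] <;> linarith
  · rw [key _ x₁ l2]
    · simp only [heading, cross]
      simp only [← Real.Angle.coe_sub, ← Real.Angle.coe_neg, Real.Angle.sin_coe, Real.Angle.cos_coe,
        Fin.reduceFinMk, Matrix.cons_val]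
      rw [show -θ - 2 * x₁ = - (2 * x₁ + θ) by ring, Real.cos_neg, Real.sin_neg, neg_neg]
    · ext i; fin_cases i <;> simp [vertexAt]

/-- The line of flight leaves the triangle through the interior of side `d`: the ends of this side
lie on opposite sides of the line, the one that follows `d` in cyclic order on the right. -/
def ExitsThrough (x₁ x₂ : ℝ) (s : Sight) (d : Fin 3) : Prop :=
  height s (vertexAt x₁ x₂ (d + 1)) < 0 ∧ 0 < height s (vertexAt x₁ x₂ (d + 2))

/-- The point in which the line of flight meets side `d`. -/
noncomputable def exitPoint (x₁ x₂ : ℝ) (s : Sight) (d : Fin 3) : Plane :=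
  (height s (vertexAt x₁ x₂ (d + 2)) /
      (height s (vertexAt x₁ x₂ (d + 2)) - height s (vertexAt x₁ x₂ (d + 1)))) •
    vertexAt x₁ x₂ (d + 1) +
  (-height s (vertexAt x₁ x₂ (d + 1)) /
      (height s (vertexAt x₁ x₂ (d + 2)) - height s (vertexAt x₁ x₂ (d + 1)))) •
    vertexAt x₁ x₂ (d + 2)

theorem exitPoint_mem {x₁ x₂ : ℝ} {s : Sight} {d : Fin 3} (h : ExitsThrough x₁ x₂ s d) :
    exitPoint x₁ x₂ s d ∈
      openSegment ℝ (vertexAt x₁ x₂ (d + 1)) (vertexAt x₁ x₂ (d + 2)) := by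
  obtain ⟨h1, h2⟩ := h
  have h3 : 0 < height s (vertexAt x₁ x₂ (d + 2)) - height s (vertexAt x₁ x₂ (d + 1)) := by
    linarith
  refine ⟨_, _, div_pos h2 h3, div_pos (neg_pos.mpr h1) h3, ?_, rfl⟩
  field_simp
  ring

/-- A directed line that has the vertex `B` of the positively oriented triangle `ABC` on its right
and the others on its left enters through `AB` and leaves through `BC`. -/
theorem exit_displacement (s : Sight) (A B C : Plane)
    (hor : 0 < (B 0 - A 0) * (C 1 - A 1) - (B 1 - A 1) * (C 0 - A 0))
    (hA : 0 < height s A) (hB : height s B < 0) (hC : 0 < height s C) :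
    ∃ c : ℝ, 0 < c ∧
      ((height s C / (height s C - height s B)) • B +
        (-height s B / (height s C - height s B)) • C) -
      ((-height s B / (height s A - height s B)) • A +
        (height s A / (height s A - height s B)) • B) = c • heading s := by
  have h1 : 0 < height s A - height s B := by linarith
  have h2 : 0 < height s C - height s B := by linarith
  refine ⟨-height s B / ((height s A - height s B) * (height s C - height s B)) *
    ((B 0 - A 0) * (C 1 - A 1) - (B 1 - A 1) * (C 0 - A 0)),
    mul_pos (div_pos (neg_pos.mpr hB) (mul_pos h1 h2)) hor, ?_⟩
  ext i
  fin_cases i <;> simp [heading] <;> field_simp <;> simp only [height] <;> ring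

/-- A directed line that has the vertex `A` of the positively oriented triangle `ABC` on its left
and the others on its right enters through `AB` and leaves through `CA`. -/
theorem exit_displacement' (s : Sight) (A B C : Plane)
    (hor : 0 < (B 0 - A 0) * (C 1 - A 1) - (B 1 - A 1) * (C 0 - A 0))
    (hA : 0 < height s A) (hB : height s B < 0) (hC : height s C < 0) :
    ∃ c : ℝ, 0 < c ∧
      ((height s A / (height s A - height s C)) • C +
        (-height s C / (height s A - height s C)) • A) -
      ((-height s B / (height s A - height s B)) • A +
        (height s A / (height s A - height s B)) • B) = c • heading s := by
  have h1 : 0 < height s A - height s B := by linarith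
  have h2 : 0 < height s A - height s C := by linarith
  refine ⟨height s A / ((height s A - height s B) * (height s A - height s C)) *
    ((B 0 - A 0) * (C 1 - A 1) - (B 1 - A 1) * (C 0 - A 0)),
    mul_pos (div_pos hA (mul_pos h1 h2)) hor, ?_⟩
  ext i
  fin_cases i <;> simp [heading] <;> field_simp <;> simp only [height] <;> ring

/-- Between two bounces the ball moves in the direction of flight. -/
theorem exitPoint_sub {x₁ x₂ : ℝ} (h : Real.sin (x₁ + x₂) ≠ 0)
    (hl : 0 < legTwo x₁ x₂ * Real.sin x₁) {s : Sight} {d d' : Fin 3}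
    (hd : ExitsThrough x₁ x₂ s d) (hd' : ExitsThrough x₁ x₂ (cross x₁ x₂ s d) d') :
    ∃ c : ℝ, 0 < c ∧ exitPoint x₁ x₂ (cross x₁ x₂ s d) d' - exitPoint x₁ x₂ s d
      = c • heading (cross x₁ x₂ s d) := by
  obtain ⟨e1, e2⟩ := height_cross_ends x₁ x₂ h s d
  obtain ⟨a1, a2⟩ := hd
  obtain ⟨b1, b2⟩ := hd'
  set t := cross x₁ x₂ s d with ht
  have f1 : height s (vertexAt x₁ x₂ (d + 1)) = -height t (vertexAt x₁ x₂ (d + 1)) := by linarith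
  have f2 : height s (vertexAt x₁ x₂ (d + 2)) = -height t (vertexAt x₁ x₂ (d + 2)) := by linarith
  have hor : 0 < (vertexAt x₁ x₂ (d + 2) 0 - vertexAt x₁ x₂ (d + 1) 0) *
        (vertexAt x₁ x₂ d 1 - vertexAt x₁ x₂ (d + 1) 1) -
      (vertexAt x₁ x₂ (d + 2) 1 - vertexAt x₁ x₂ (d + 1) 1) *
        (vertexAt x₁ x₂ d 0 - vertexAt x₁ x₂ (d + 1) 0) := by
    fin_cases d <;> simp [vertexAt] <;> nlinarith
  have hp : exitPoint x₁ x₂ s d =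
      (-height t (vertexAt x₁ x₂ (d + 2)) /
        (height t (vertexAt x₁ x₂ (d + 1)) - height t (vertexAt x₁ x₂ (d + 2)))) •
        vertexAt x₁ x₂ (d + 1) +
      (height t (vertexAt x₁ x₂ (d + 1)) /
        (height t (vertexAt x₁ x₂ (d + 1)) - height t (vertexAt x₁ x₂ (d + 2)))) •
        vertexAt x₁ x₂ (d + 2) := by
    unfold exitPoint
    rw [f1, f2]
    congr 3 <;> ring
  rw [hp]
  have hA : 0 < height t (vertexAt x₁ x₂ (d + 1)) := by linarith
  have hB : height t (vertexAt x₁ x₂ (d + 2)) < 0 := by linarith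
  have hcases : d' = d ∨ d' = d + 1 ∨ d' = d + 2 := by
    have : ∀ d d' : Fin 3, d' = d ∨ d' = d + 1 ∨ d' = d + 2 := by decide
    exact this d d'
  rcases hcases with rfl | rfl | rfl
  · exact absurd b1 (not_lt.mpr hA.le)
  · have i1 : d + 1 + 1 = d + 2 := (by decide : ∀ d : Fin 3, d + 1 + 1 = d + 2) d
    have i2 : d + 1 + 2 = d := (by decide : ∀ d : Fin 3, d + 1 + 2 = d) d
    unfold exitPoint
    rw [i1] at b1 ⊢
    rw [i2] at b2 ⊢
    exact exit_displacement t _ _ _ hor hA hB b2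
  · have i1 : d + 2 + 1 = d := (by decide : ∀ d : Fin 3, d + 2 + 1 = d) d
    have i2 : d + 2 + 2 = d + 1 := (by decide : ∀ d : Fin 3, d + 2 + 2 = d + 1) d
    unfold exitPoint
    rw [i1] at b1 ⊢
    rw [i2] at b2 ⊢
    exact exit_displacement' t _ _ _ hor hA hB b1

/-! ### Words realized by a line of flight -/

/-- Starting from the line of flight `s`, the ball hits the sides given by the word in this order,
and then has the line of flight `s'`. -/
def Follows (x₁ x₂ : ℝ) : List (Fin 3) → Sight → Sight → Prop
  | [], s, s' => s = s'
  | d :: w, s, s' => ExitsThrough x₁ x₂ s d ∧ Follows x₁ x₂ w (cross x₁ x₂ s d) s'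

theorem Follows.append {x₁ x₂ : ℝ} {w w' : List (Fin 3)} {s t r : Sight}
    (h : Follows x₁ x₂ w s t) (h' : Follows x₁ x₂ w' t r) : Follows x₁ x₂ (w ++ w') s r := by
  induction w generalizing s with
  | nil => cases h; exact h'
  | cons d w ih => exact ⟨h.1, ih h.2⟩

theorem Follows.exists_of_append {x₁ x₂ : ℝ} {w w' : List (Fin 3)} {s r : Sight}
    (h : Follows x₁ x₂ (w ++ w') s r) : ∃ t, Follows x₁ x₂ w s t ∧ Follows x₁ x₂ w' t r := by
  induction w generalizing s with
  | nil => exact ⟨s, rfl, h⟩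
  | cons d w ih =>
    obtain ⟨t, h1, h2⟩ := ih h.2
    exact ⟨t, ⟨h.1, h1⟩, h2⟩

/-- The successive lines of flight along the periodic word with period `W`. -/
noncomputable def sightSeq (x₁ x₂ : ℝ) (W : List (Fin 3)) (s : Sight) : ℕ → Sight
  | 0 => s
  | i + 1 => cross x₁ x₂ (sightSeq x₁ x₂ W s i) (digit W i)

/-- After `i` bounces the rest of the current period leads back to `s`. The second part is needed
at the end of a period, where the remainder `i % W.length` jumps back to `0`. -/
theorem Follows.drop_sightSeq {x₁ x₂ : ℝ} {W : List (Fin 3)} {s : Sight} (hW : W ≠ [])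
    (h : Follows x₁ x₂ W s s) (i : ℕ) :
    Follows x₁ x₂ (W.drop (i % W.length)) (sightSeq x₁ x₂ W s i) s ∧
      (i % W.length = 0 → sightSeq x₁ x₂ W s i = s) := by
  have hL : 0 < W.length := List.length_pos_of_ne_nil hW
  induction i with
  | zero => simpa [sightSeq] using h
  | succ i ih =>
    have hr : i % W.length < W.length := Nat.mod_lt _ hL
    have h1 := ih.1
    have hdig : digit W i = W[i % W.length] := by
      unfold digit
      rw [List.getD_eq_getElem _ _ hr]
    rw [List.drop_eq_getElem_cons hr, ← hdig] at h1
    have h2 := h1.2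
    rw [← Nat.mod_add_mod]
    rcases lt_or_eq_of_le (Nat.succ_le_of_lt hr) with hlt | heq
    · rw [Nat.mod_eq_of_lt hlt]
      exact ⟨h2, fun h0 => absurd h0 (Nat.succ_ne_zero _)⟩
    · rw [Nat.succ_eq_add_one] at heq
      rw [heq, List.drop_length] at h2
      have h3 : sightSeq x₁ x₂ W s (i + 1) = s := h2
      rw [heq, Nat.mod_self, h3]
      exact ⟨h, fun _ => rfl⟩

theorem Follows.exitsThrough {x₁ x₂ : ℝ} {W : List (Fin 3)} {s : Sight} (hW : W ≠ [])
    (h : Follows x₁ x₂ W s s) (i : ℕ) :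
    ExitsThrough x₁ x₂ (sightSeq x₁ x₂ W s i) (digit W i) := by
  have hr : i % W.length < W.length := Nat.mod_lt _ (List.length_pos_of_ne_nil hW)
  have h1 := (h.drop_sightSeq hW i).1
  have hdig : digit W i = W[i % W.length] := by
    unfold digit
    rw [List.getD_eq_getElem _ _ hr]
  rw [List.drop_eq_getElem_cons hr, ← hdig] at h1
  exact h1.1

theorem digit_add_length (W : List (Fin 3)) (i : ℕ) : digit W (i + W.length) = digit W i := by
  simp [digit]

theorem Follows.sightSeq_periodic {x₁ x₂ : ℝ} {W : List (Fin 3)} {s : Sight} (hW : W ≠ [])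
    (h : Follows x₁ x₂ W s s) (i : ℕ) :
    sightSeq x₁ x₂ W s (i + W.length) = sightSeq x₁ x₂ W s i := by
  induction i with
  | zero => simpa [sightSeq] using (h.drop_sightSeq hW W.length).2 (Nat.mod_self _)
  | succ i ih =>
    rw [Nat.add_right_comm, sightSeq, sightSeq, ih, digit_add_length]

theorem affineIndependent_vertexAt {x₁ x₂ : ℝ} (hl : 0 < legTwo x₁ x₂ * Real.sin x₁) :
    AffineIndependent ℝ (vertexAt x₁ x₂) := by
  rw [affineIndependent_iff_of_fintype]
  intro w hw h
  rw [Finset.weightedVSub_eq_linear_combination _ hw] at h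
  have h0 := congrFun (congrArg WithLp.ofLp h) 0
  have h1 := congrFun (congrArg WithLp.ofLp h) 1
  simp only [Fin.sum_univ_three] at hw h0 h1
  simp [vertexAt] at h0 h1
  have w0 : w 0 = 0 := by
    rcases h1 with h1 | h1 | h1
    · exact h1
    · rw [h1, zero_mul] at hl; exact absurd hl (lt_irrefl _)
    · rw [h1, mul_zero] at hl; exact absurd hl (lt_irrefl _)
  rw [w0] at h0 hw
  have w2 : w 2 = 0 := by linarith
  intro i
  fin_cases i
  · exact w0
  · simp only [Fin.mk_one]; linarith
  · exact w2

theorem angle_polar {x r : ℝ} (h0 : 0 ≤ x) (h1 : x ≤ Real.pi) (hr : 0 < r) :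
    InnerProductGeometry.angle (!₂[1, 0] : Plane) (r • !₂[Real.cos x, Real.sin x]) = x := by
  rw [InnerProductGeometry.angle_smul_right_of_pos _ _ hr, InnerProductGeometry.angle]
  have h2 : ‖(!₂[Real.cos x, Real.sin x] : Plane)‖ = 1 := by
    rw [EuclideanSpace.norm_eq]
    simp [Fin.sum_univ_two]
  have h3 : ‖(!₂[1, 0] : Plane)‖ = 1 := by
    rw [EuclideanSpace.norm_eq]
    simp [Fin.sum_univ_two]
  rw [h2, h3]
  simp [PiLp.inner_apply, Fin.sum_univ_two]
  exact Real.arccos_cos h0 h1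

/-- A line of flight that returns to itself after the bounces given by `W` gives a periodic billiard
path. -/
theorem mem_orbitTile_of_follows {X : Plane} (hX : X ∈ paramSpace) {W : List (Fin 3)}
    (hW : W ≠ []) {s : Sight} (h : Follows (X 0) (X 1) W s s) : X ∈ orbitTile W := by
  obtain ⟨h0, h1, h01⟩ := hX
  have s0 : 0 < Real.sin (X 0) := Real.sin_pos_of_pos_of_lt_pi h0 (by linarith)
  have s1 : 0 < Real.sin (X 1) := Real.sin_pos_of_pos_of_lt_pi h1 (by linarith)
  have s01 : 0 < Real.sin (X 0 + X 1) := Real.sin_pos_of_pos_of_lt_pi (by linarith) (by linarith)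
  have l1 : 0 < legOne (X 0) (X 1) := div_pos s0 s01
  have l2 : 0 < legTwo (X 0) (X 1) := div_pos s1 s01
  have hl := mul_pos l2 s0
  set T : Affine.Triangle ℝ Plane := ⟨vertexAt (X 0) (X 1), affineIndependent_vertexAt hl⟩ with hT
  have e1 := leg_sum_cos s01.ne'
  have e2 := leg_sin (x₁ := X 0) (x₂ := X 1)
  refine ⟨⟨h0, h1, h01⟩, hW, T, ⟨?_, ?_⟩,
    fun i => exitPoint (X 0) (X 1) (sightSeq (X 0) (X 1) W s i) (digit W i), ?_, ?_, ?_, ?_⟩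
  · have : T.points 2 -ᵥ T.points 1 = !₂[1, 0] := by
      ext i; fin_cases i <;> simp [hT, vertexAt]
    rw [EuclideanGeometry.angle, this]
    have : T.points 3 -ᵥ T.points 1
        = legTwo (X 0) (X 1) • !₂[Real.cos (X 0), Real.sin (X 0)] := by
      change T.points 0 -ᵥ T.points 1 = _
      ext i; fin_cases i <;> simp [hT, vertexAt]
    rw [this]
    exact angle_polar h0.le (by linarith) l2
  · have : T.points 1 -ᵥ T.points 2 = -!₂[1, 0] := by
      ext i; fin_cases i <;> simp [hT, vertexAt]
    rw [EuclideanGeometry.angle, this, InnerProductGeometry.angle_neg_left]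
    have : T.points 3 -ᵥ T.points 2
        = legOne (X 0) (X 1) • !₂[Real.cos (Real.pi - X 1), Real.sin (Real.pi - X 1)] := by
      change T.points 0 -ᵥ T.points 2 = _
      ext i; fin_cases i <;> simp [hT, vertexAt] <;> linarith
    rw [this, angle_polar (by linarith) (by linarith) l1]
    ring
  · intro i
    simp only [h.sightSeq_periodic hW, digit_add_length]
  · intro i
    exact exitPoint_mem (h.exitsThrough hW i)
  · intro i hi
    obtain ⟨c, hc, hsub⟩ := exitPoint_sub s01.ne' hl (h.exitsThrough hW i)
      (h.exitsThrough hW (i + 1))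
    have h3 : c • heading (cross (X 0) (X 1) (sightSeq (X 0) (X 1) W s i) (digit W i)) = 0 := by
      rw [← hsub, sub_eq_zero]; exact hi.symm
    have h4 := (smul_eq_zero.mp h3).resolve_left hc.ne'
    have h5 := congrFun (congrArg WithLp.ofLp h4) 0
    have h6 := congrFun (congrArg WithLp.ofLp h4) 1
    simp [heading] at h5 h6
    have := Real.Angle.cos_sq_add_sin_sq
      (cross (X 0) (X 1) (sightSeq (X 0) (X 1) W s i) (digit W i)).1
    rw [h5, h6] at this
    norm_num at this
  · intro i
    obtain ⟨c, hc, hsub⟩ := exitPoint_sub s01.ne' hl (h.exitsThrough hW i)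
      (h.exitsThrough hW (i + 1))
    obtain ⟨c', hc', hsub'⟩ := exitPoint_sub s01.ne' hl (h.exitsThrough hW (i + 1))
      (h.exitsThrough hW (i + 2))
    have hA : exitPoint (X 0) (X 1) (sightSeq (X 0) (X 1) W s (i + 1)) (digit W (i + 1)) -
        exitPoint (X 0) (X 1) (sightSeq (X 0) (X 1) W s i) (digit W i)
          = c • heading (sightSeq (X 0) (X 1) W s (i + 1)) := hsub
    have hB : exitPoint (X 0) (X 1) (sightSeq (X 0) (X 1) W s (i + 2)) (digit W (i + 2)) -
        exitPoint (X 0) (X 1) (sightSeq (X 0) (X 1) W s (i + 1)) (digit W (i + 1))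
          = c' • heading (sightSeq (X 0) (X 1) W s (i + 2)) := hsub'
    simp only [hA, hB, map_smul]
    rw [sideReflection_heading s01.ne' s0.ne' s1.ne' T rfl]
    exact ((SameRay.refl _).nonneg_smul_left hc.le).nonneg_smul_right hc'.le

/-! ### Lines of flight given by their direction and the height of the vertex `1` -/

/-- The line of flight in the direction of the angle `Θ`, above which the vertex `1` has the
height `Y`. -/
noncomputable def sight (Θ Y : ℝ) : Sight := (((-Θ : ℝ) : Real.Angle), Y)

theorem height_sight_one (x₁ x₂ Θ Y : ℝ) : height (sight Θ Y) (vertexAt x₁ x₂ 1) = Y := by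
  simp [height, sight, vertexAt]

theorem height_sight_two (x₁ x₂ Θ Y : ℝ) :
    height (sight Θ Y) (vertexAt x₁ x₂ 2) = Y - Real.sin Θ := by
  simp [height, sight, vertexAt]; ring

theorem height_sight_zero (x₁ x₂ Θ Y : ℝ) :
    height (sight Θ Y) (vertexAt x₁ x₂ 0) = Y - legTwo x₁ x₂ * Real.sin (Θ - x₁) := by
  simp [height, sight, vertexAt, Real.sin_sub]; ring

theorem cross_sight_zero (x₁ x₂ Θ Y : ℝ) : cross x₁ x₂ (sight Θ Y) 0 = sight (-Θ) (-Y) := by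
  simp [cross, sight]

theorem cross_sight_one (x₁ x₂ Θ Y : ℝ) : cross x₁ x₂ (sight Θ Y) 1 =
    sight (-Θ - 2 * x₂) (Real.sin Θ - Y - Real.sin (Θ + 2 * x₂)) := by
  have h : ((2 * x₂ : ℝ) : Real.Angle) - ((-Θ : ℝ) : Real.Angle)
      = ((-(-Θ - 2 * x₂) : ℝ) : Real.Angle) := by
    rw [← Real.Angle.coe_sub]; congr 1; ring
  simp only [cross, sight, Matrix.cons_val_one, Matrix.cons_val_zero, h, Real.Angle.sin_coe]
  rw [Real.sin_neg, show -(-Θ - 2 * x₂) = Θ + 2 * x₂ by ring]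
  congr 1; ring

theorem cross_sight_two (x₁ x₂ Θ Y : ℝ) :
    cross x₁ x₂ (sight Θ Y) 2 = sight (2 * x₁ - Θ) (-Y) := by
  simp only [cross, sight, Matrix.cons_val, ← Real.Angle.coe_neg, ← Real.Angle.coe_sub]
  congr 2; ring

theorem exitsThrough_zero_iff (x₁ x₂ Θ Y : ℝ) :
    ExitsThrough x₁ x₂ (sight Θ Y) 0 ↔ Y < 0 ∧ Real.sin Θ < Y := by
  simp only [ExitsThrough, zero_add, height_sight_one, height_sight_two, sub_pos]

theorem exitsThrough_one_iff (x₁ x₂ Θ Y : ℝ) :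
    ExitsThrough x₁ x₂ (sight Θ Y) 1 ↔
      Y < Real.sin Θ ∧ legTwo x₁ x₂ * Real.sin (Θ - x₁) < Y := by
  change height (sight Θ Y) (vertexAt x₁ x₂ 2) < 0 ∧ 0 < height (sight Θ Y) (vertexAt x₁ x₂ 0) ↔ _
  simp only [height_sight_zero, height_sight_two, sub_pos, sub_neg]

theorem exitsThrough_two_iff (x₁ x₂ Θ Y : ℝ) :
    ExitsThrough x₁ x₂ (sight Θ Y) 2 ↔ Y < legTwo x₁ x₂ * Real.sin (Θ - x₁) ∧ 0 < Y := by
  change height (sight Θ Y) (vertexAt x₁ x₂ 0) < 0 ∧ 0 < height (sight Θ Y) (vertexAt x₁ x₂ 1) ↔ _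
  simp only [height_sight_zero, height_sight_one, sub_neg]

/-- Mirror image of a line of flight in the perpendicular bisector of side `3`, directed so that
all heights change sign and the direction `Θ` becomes `π - Θ`. It is a line of flight for the
triangle with the vertices `1` and `2` interchanged. -/
noncomputable def mirror (s : Sight) : Sight := ((Real.pi : Real.Angle) - s.1, -s.2 - s.1.sin)

theorem mirror_sight (Θ Y : ℝ) : mirror (sight Θ Y) = sight (Real.pi - Θ) (Real.sin Θ - Y) := by
  have h : (Real.pi : Real.Angle) - ((-Θ : ℝ) : Real.Angle)
      = ((-(Real.pi - Θ) : ℝ) : Real.Angle) := by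
    rw [← Real.Angle.coe_sub, Real.Angle.angle_eq_iff_two_pi_dvd_sub]
    exact ⟨1, by push_cast; ring⟩
  simp only [mirror, sight, h, Real.Angle.sin_coe, Real.sin_neg]
  congr 1; ring

theorem exists_eq_sight (s : Sight) : ∃ Θ Y, s = sight Θ Y := by
  obtain ⟨θ, y⟩ := s
  induction θ using Real.Angle.induction_on with
  | _ θ => exact ⟨-θ, y, by simp [sight]⟩

theorem sight_congr {Θ Θ' Y Y' : ℝ} (k : ℤ) (h : Θ = Θ' + 2 * Real.pi * k) (hY : Y = Y') :
    sight Θ Y = sight Θ' Y' := by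
  subst hY
  unfold sight
  congr 1
  rw [Real.Angle.angle_eq_iff_two_pi_dvd_sub]
  exact ⟨-k, by rw [h]; push_cast; ring⟩

theorem height_mirror {x₁ x₂ : ℝ} (h : Real.sin (x₁ + x₂) ≠ 0) (s : Sight) (d : Fin 3) :
    height (mirror s) (vertexAt x₂ x₁ (-d)) = -height s (vertexAt x₁ x₂ d) := by
  obtain ⟨Θ, Y, rfl⟩ := exists_eq_sight s
  rw [mirror_sight]
  fin_cases d
  · change height _ (vertexAt x₂ x₁ 0) = -height _ (vertexAt x₁ x₂ 0)
    rw [height_sight_zero, height_sight_zero]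
    have e1 := leg_sum_cos h
    have e2 := leg_sin (x₁ := x₁) (x₂ := x₂)
    have e3 : legTwo x₂ x₁ = legOne x₁ x₂ := by unfold legTwo legOne; rw [add_comm]
    rw [e3, show Real.pi - Θ - x₂ = Real.pi - (Θ + x₂) by ring, Real.sin_pi_sub, Real.sin_add,
      Real.sin_sub]
    linear_combination (-Real.sin Θ) * e1 + Real.cos Θ * e2
  · change height _ (vertexAt x₂ x₁ 2) = -height _ (vertexAt x₁ x₂ 1)
    rw [height_sight_one, height_sight_two, Real.sin_pi_sub]; ring
  · change height _ (vertexAt x₂ x₁ 1) = -height _ (vertexAt x₁ x₂ 2)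
    rw [height_sight_one, height_sight_two]; ring

theorem cross_mirror (x₁ x₂ : ℝ) (s : Sight) (d : Fin 3) :
    cross x₂ x₁ (mirror s) (-d) = mirror (cross x₁ x₂ s d) := by
  obtain ⟨Θ, Y, rfl⟩ := exists_eq_sight s
  rw [mirror_sight]
  fin_cases d
  · change cross x₂ x₁ _ 0 = mirror (cross x₁ x₂ _ 0)
    rw [cross_sight_zero, cross_sight_zero, mirror_sight]
    exact sight_congr (-1) (by push_cast; ring) (by rw [Real.sin_neg]; ring)
  · change cross x₂ x₁ _ 2 = mirror (cross x₁ x₂ _ 1)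
    rw [cross_sight_one, cross_sight_two, mirror_sight]
    refine sight_congr (-1) (by push_cast; ring) ?_
    rw [show -Θ - 2 * x₂ = -(Θ + 2 * x₂) by ring, Real.sin_neg]; ring
  · change cross x₂ x₁ _ 1 = mirror (cross x₁ x₂ _ 2)
    rw [cross_sight_one, cross_sight_two, mirror_sight]
    refine sight_congr (-1) (by push_cast; ring) ?_
    rw [show 2 * x₁ - Θ = -(Θ - 2 * x₁) by ring, Real.sin_neg, Real.sin_pi_sub,
      show Real.pi - Θ + 2 * x₁ = Real.pi - (Θ - 2 * x₁) by ring, Real.sin_pi_sub]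
    ring

/-- Interchange of the digits `1` and `2`; it is the negation in `Fin 3`. -/
def swapWord (w : List (Fin 3)) : List (Fin 3) := w.map (fun d => -d)

theorem Follows.mirror {x₁ x₂ : ℝ} (hx : Real.sin (x₁ + x₂) ≠ 0) {w : List (Fin 3)}
    {s t : Sight} (h : Follows x₁ x₂ w s t) :
    Follows x₂ x₁ (swapWord w) (mirror s) (mirror t) := by
  induction w generalizing s with
  | nil => cases h; exact rfl
  | cons d w ih =>
    refine ⟨?_, ?_⟩
    · have i1 : -d + 1 = -(d + 2) := (by decide : ∀ d : Fin 3, -d + 1 = -(d + 2)) d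
      have i2 : -d + 2 = -(d + 1) := (by decide : ∀ d : Fin 3, -d + 2 = -(d + 1)) d
      obtain ⟨h1, h2⟩ := h.1
      unfold ExitsThrough
      rw [i1, i2, height_mirror hx, height_mirror hx]
      exact ⟨by linarith, by linarith⟩
    · rw [cross_mirror]
      exact ih h.2

/-! ### Fans and corners -/

theorem wordPow_succ (u : List (Fin 3)) (k : ℕ) : wordPow u (k + 1) = u ++ wordPow u k := rfl

theorem wordPow_succ' (u : List (Fin 3)) (k : ℕ) : wordPow u (k + 1) = wordPow u k ++ u := by
  simp [wordPow, List.replicate_succ']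

theorem swapWord_append (u v : List (Fin 3)) : swapWord (u ++ v) = swapWord u ++ swapWord v :=
  List.map_append

theorem swapWord_wordPow (u : List (Fin 3)) (k : ℕ) :
    swapWord (wordPow u k) = wordPow (swapWord u) k := by
  simp [swapWord, wordPow, List.map_flatten]

theorem Follows.mirror_sight {x₁ x₂ : ℝ} (hx : Real.sin (x₁ + x₂) ≠ 0) {w : List (Fin 3)}
    {Θ Θ' Z Z' : ℝ} (h : Follows x₂ x₁ w (sight Θ Z) (sight Θ' Z')) :
    Follows x₁ x₂ (swapWord w) (sight (Real.pi - Θ) (Real.sin Θ - Z))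
      (sight (Real.pi - Θ') (Real.sin Θ' - Z')) := by
  rw [← _root_.mirror_sight, ← _root_.mirror_sight]
  exact h.mirror (by rwa [add_comm])

theorem sin_le_sin_of_mem {ν t : ℝ} (h0 : 0 ≤ ν) (h1 : ν ≤ t) (h2 : t ≤ Real.pi - ν) :
    Real.sin ν ≤ Real.sin t := by
  rcases le_total t (Real.pi / 2) with h | h
  · exact Real.sin_le_sin_of_le_of_le_pi_div_two (by linarith [Real.pi_pos]) h h1
  · rw [← Real.sin_pi_sub t]
    exact Real.sin_le_sin_of_le_of_le_pi_div_two (by linarith [Real.pi_pos]) (by linarith)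
      (by linarith)

/-- The vertical extent of a long side of slope `t` is the sum of those of the two short sides on
it. -/
theorem leg_decomposition {x₁ x₂ : ℝ} (h : Real.sin (x₁ + x₂) ≠ 0) (t : ℝ) :
    Real.sin t = legTwo x₁ x₂ * Real.sin (t + x₁) + legOne x₁ x₂ * Real.sin (t - x₂) := by
  have e1 := leg_sum_cos h
  have e2 := leg_sin (x₁ := x₁) (x₂ := x₂)
  rw [Real.sin_add, Real.sin_sub]
  linear_combination (-Real.sin t) * e1 - Real.cos t * e2

theorem legOne_swap (x₁ x₂ : ℝ) : legOne x₂ x₁ = legTwo x₁ x₂ := by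
  unfold legOne legTwo; rw [add_comm]

theorem legTwo_swap (x₁ x₂ : ℝ) : legTwo x₂ x₁ = legOne x₁ x₂ := by
  unfold legOne legTwo; rw [add_comm]

/-- A fan of `2 * m` triangles around the vertex `1`, which is at height `Y` above the line of
flight. The first and the last long side make the angles `p` and `r` with the line. The bounds `ν`
for the angles of the long sides and `κ` for those of the short sides keep the outer vertices below
the line. -/
theorem follows_fan {x₁ x₂ Y ν κ : ℝ} (hx₁ : 0 ≤ x₁) (hl : 0 ≤ legTwo x₁ x₂) (hY : 0 < Y)
    (hν : 0 ≤ ν) (hκ : 0 ≤ κ) (hYν : Y < Real.sin ν) (hYκ : Y < legTwo x₁ x₂ * Real.sin κ)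
    {r : ℝ} (hr : ν ≤ r) (hr' : κ ≤ r + x₁) (m : ℕ) {p : ℝ} (hp : ν ≤ p) (hp' : κ ≤ p + x₁)
    (hm : p + r + 2 * m * x₁ = Real.pi) :
    Follows x₁ x₂ (wordPow [2, 3] m) (sight (Real.pi - p) Y) (sight r Y) := by
  induction m generalizing p with
  | zero =>
    have : Real.pi - p = r := by push_cast at hm; linarith
    rw [this]; exact rfl
  | succ m ih =>
    push_cast at hm
    have hmx : 0 ≤ (m : ℝ) * x₁ := by positivity
    have h1 : Y < legTwo x₁ x₂ * Real.sin (Real.pi - p - x₁) := by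
      rw [show Real.pi - p - x₁ = Real.pi - (p + x₁) by ring, Real.sin_pi_sub]
      exact hYκ.trans_le (mul_le_mul_of_nonneg_left
        (sin_le_sin_of_mem hκ hp' (by linarith)) hl)
    have h2 : Y < Real.sin (p + 2 * x₁) :=
      hYν.trans_le (sin_le_sin_of_mem hν (by linarith) (by linarith))
    refine ⟨(exitsThrough_two_iff _ _ _ _).mpr ⟨h1, hY⟩, ?_⟩
    rw [cross_sight_two]
    refine ⟨(exitsThrough_zero_iff _ _ _ _).mpr ⟨by linarith, ?_⟩, ?_⟩
    · rw [show 2 * x₁ - (Real.pi - p) = p + 2 * x₁ - Real.pi by ring, Real.sin_sub_pi]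
      linarith
    · change Follows x₁ x₂ (wordPow [2, 3] m) (cross x₁ x₂ _ 0) _
      rw [cross_sight_zero, neg_neg,
        show -(2 * x₁ - (Real.pi - p)) = Real.pi - (p + 2 * x₁) by ring]
      exact ih (by linarith) (by linarith) (by linarith)

/-- A fan around the vertex `2`, which is at depth `Z` below the line of flight. -/
theorem follows_fan_mirror {x₁ x₂ Z ν κ : ℝ} (hx : Real.sin (x₁ + x₂) ≠ 0) (hx₂ : 0 ≤ x₂)
    (hl : 0 ≤ legOne x₁ x₂) (hZ : 0 < Z)
    (hν : 0 ≤ ν) (hκ : 0 ≤ κ) (hZν : Z < Real.sin ν) (hZκ : Z < legOne x₁ x₂ * Real.sin κ)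
    {r : ℝ} (hr : ν ≤ r) (hr' : κ ≤ r + x₂) (m : ℕ) {p : ℝ} (hp : ν ≤ p) (hp' : κ ≤ p + x₂)
    (hm : p + r + 2 * m * x₂ = Real.pi) :
    Follows x₁ x₂ (wordPow [1, 3] m) (sight p (Real.sin p - Z))
      (sight (Real.pi - r) (Real.sin r - Z)) := by
  rw [← legTwo_swap] at hl hZκ
  have h := (follows_fan hx₂ hl hZ hν hκ hZν hZκ hr hr' m hp hp' hm).mirror_sight hx
  rw [swapWord_wordPow, Real.sin_pi_sub, sub_sub_cancel] at h
  exact h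

/-- Passage from a fan around the vertex `2`, at depth `Z`, to a fan around the vertex `1` on the
same side of the unfolded line of flight. -/
theorem follows_corner {x₁ x₂ q Z : ℝ} (hx : Real.sin (x₁ + x₂) ≠ 0) (hZ : 0 < Z)
    (hZ' : Z < legOne x₁ x₂ * Real.sin (q - x₂)) (hY : 0 < Z - Real.sin (q - 2 * x₂))
    (hY' : Z - Real.sin (q - 2 * x₂) < Real.sin (2 * x₁ + 2 * x₂ - q)) :
    Follows x₁ x₂ [1, 2, 3] (sight (Real.pi - q) (Real.sin q - Z))
      (sight (Real.pi - (2 * x₁ + 2 * x₂ - q)) (Z - Real.sin (q - 2 * x₂))) := by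
  have d1 := leg_decomposition hx q
  have e1 : Real.sin (Real.pi - q - x₁) = Real.sin (q + x₁) := by
    rw [show Real.pi - q - x₁ = Real.pi - (q + x₁) by ring, Real.sin_pi_sub]
  have e2 : Real.sin (Real.pi - q + 2 * x₂) = Real.sin (q - 2 * x₂) := by
    rw [show Real.pi - q + 2 * x₂ = Real.pi - (q - 2 * x₂) by ring, Real.sin_pi_sub]
  have e3 : Real.sin (-(Real.pi - q) - 2 * x₂ - x₁) = - Real.sin (q - x₂ - (x₁ + x₂)) := by
    rw [show -(Real.pi - q) - 2 * x₂ - x₁ = q - x₂ - (x₁ + x₂) - Real.pi by ring, Real.sin_sub_pi]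
  refine ⟨(exitsThrough_one_iff _ _ _ _).mpr ⟨?_, ?_⟩, ?_⟩
  · rw [Real.sin_pi_sub]; linarith
  · rw [e1]; linarith
  · rw [cross_sight_one, e2, Real.sin_pi_sub, sub_sub_cancel]
    refine ⟨(exitsThrough_two_iff _ _ _ _).mpr ⟨?_, hY⟩, ?_⟩
    · have d3 := leg_decomposition hx (-(q - 2 * x₂))
      rw [show -(q - 2 * x₂) + x₁ = -(q - x₂ - (x₁ + x₂)) by ring,
        show -(q - 2 * x₂) - x₂ = -(q - x₂) by ring, Real.sin_neg, Real.sin_neg, Real.sin_neg] at d3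
      rw [e3]
      linarith
    · rw [cross_sight_two]
      refine ⟨(exitsThrough_zero_iff _ _ _ _).mpr ⟨by linarith, ?_⟩, ?_⟩
      · rw [show 2 * x₁ - (-(Real.pi - q) - 2 * x₂) = 2 * x₁ + 2 * x₂ - q + Real.pi by ring,
          Real.sin_add_pi]
        linarith
      · change cross x₁ x₂ _ 0 = _
        rw [cross_sight_zero]
        exact sight_congr (-1) (by push_cast; ring) (by ring)

/-- Passage from a fan around the vertex `1`, at height `Y`, to a fan around the vertex `2` on the
same side of the unfolded line of flight. -/
theorem follows_corner_mirror {x₁ x₂ q Y : ℝ} (hx : Real.sin (x₁ + x₂) ≠ 0) (hY : 0 < Y)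
    (hY' : Y < legTwo x₁ x₂ * Real.sin (q - x₁)) (hZ : 0 < Y - Real.sin (q - 2 * x₁))
    (hZ' : Y - Real.sin (q - 2 * x₁) < Real.sin (2 * x₁ + 2 * x₂ - q)) :
    Follows x₁ x₂ [2, 1, 3] (sight q Y)
      (sight (2 * x₁ + 2 * x₂ - q)
        (Real.sin (2 * x₁ + 2 * x₂ - q) - (Y - Real.sin (q - 2 * x₁)))) := by
  rw [← legOne_swap] at hY'
  have e : 2 * x₁ + 2 * x₂ - q = 2 * x₂ + 2 * x₁ - q := by ring
  rw [e] at hZ' ⊢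
  have h := (follows_corner (by rwa [add_comm]) hY hY' hZ hZ').mirror_sight hx
  rw [Real.sin_pi_sub, Real.sin_pi_sub, sub_sub_cancel, sub_sub_cancel, sub_sub_cancel] at h
  exact h

/-! ### Zigzags -/

/-- Bounds on the base angles `x₁`, `x₂` and on a range `[lo, hi]` of slopes, which allow to compare
the sines of all angles that occur in a zigzag. In the regular case `x₁ = x₂ = γ` with
`2 * (N + 1) * γ = π` they hold for `lo = 2 * γ / 3` and `hi = γ`. -/
structure SlopeRange (N : ℕ) (x₁ x₂ lo hi : ℝ) : Prop where
  lo_pos : 0 < lo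
  hi_le_left : hi ≤ x₁
  hi_le_right : hi ≤ x₂
  left_le : x₁ ≤ 2 * lo
  right_le : x₂ ≤ 2 * lo
  add_hi_le : x₁ + hi ≤ Real.pi - 2 * N * x₁
  add_hi_le' : x₂ + hi ≤ Real.pi - 2 * N * x₂
  cross_add_hi_le : x₁ + hi ≤ Real.pi - 2 * N * x₂
  cross_add_hi_le' : x₂ + hi ≤ Real.pi - 2 * N * x₁
  le_lo : Real.pi - 2 * N * x₁ ≤ 3 * lo
  le_lo' : Real.pi - 2 * N * x₂ ≤ 3 * lo
  lo_le : 9 * lo ≤ Real.pi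

namespace SlopeRange
variable {N : ℕ} {x₁ x₂ lo hi : ℝ}

theorem symm (h : SlopeRange N x₁ x₂ lo hi) : SlopeRange N x₂ x₁ lo hi :=
  ⟨h.lo_pos, h.hi_le_right, h.hi_le_left, h.right_le, h.left_le, h.add_hi_le', h.add_hi_le,
    h.cross_add_hi_le', h.cross_add_hi_le, h.le_lo', h.le_lo, h.lo_le⟩

theorem left_pos (h : SlopeRange N x₁ x₂ lo hi) {u : ℝ} (hu : u ∈ Set.Icc lo hi) : 0 < x₁ := by
  linarith [h.lo_pos, hu.1, hu.2, h.hi_le_left]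

theorem sin_add_pos (h : SlopeRange N x₁ x₂ lo hi) {u : ℝ} (hu : u ∈ Set.Icc lo hi) :
    0 < Real.sin (x₁ + x₂) :=
  Real.sin_pos_of_pos_of_lt_pi (by linarith [h.left_pos hu, h.symm.left_pos hu])
    (by linarith [h.left_le, h.right_le, h.lo_le, h.lo_pos])

theorem sin_right_pos (h : SlopeRange N x₁ x₂ lo hi) {u : ℝ} (hu : u ∈ Set.Icc lo hi) :
    0 < Real.sin x₂ :=
  Real.sin_pos_of_pos_of_lt_pi (h.symm.left_pos hu)
    (by linarith [h.left_le, h.right_le, h.lo_le, h.lo_pos])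

theorem legTwo_pos (h : SlopeRange N x₁ x₂ lo hi) {u : ℝ} (hu : u ∈ Set.Icc lo hi) :
    0 < legTwo x₁ x₂ :=
  div_pos (h.sin_right_pos hu) (h.sin_add_pos hu)

theorem legOne_pos (h : SlopeRange N x₁ x₂ lo hi) {u : ℝ} (hu : u ∈ Set.Icc lo hi) :
    0 < legOne x₁ x₂ := by
  rw [← legTwo_swap]; exact h.symm.legTwo_pos hu

theorem legTwo_le_one (h : SlopeRange N x₁ x₂ lo hi) {u : ℝ} (hu : u ∈ Set.Icc lo hi) :
    legTwo x₁ x₂ ≤ 1 := by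
  rw [legTwo, div_le_one (h.sin_add_pos hu)]
  have := h.lo_pos
  exact Real.sin_le_sin_of_le_of_le_pi_div_two
    (by linarith [h.symm.left_pos hu, Real.pi_pos])
    (by linarith [h.left_le, h.right_le, h.lo_le]) (by linarith [h.left_pos hu])

/-- The short side next to a long side of slope `u ≤ hi` in a fan spans a greater height. -/
theorem sin_le_legTwo (h : SlopeRange N x₁ x₂ lo hi) {u : ℝ} (hu : u ∈ Set.Icc lo hi) :
    Real.sin u ≤ legTwo x₁ x₂ * Real.sin (u + x₁) := by
  have d := leg_decomposition (h.sin_add_pos hu).ne' u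
  have : Real.sin (u - x₂) ≤ 0 := Real.sin_nonpos_of_nonpos_of_neg_pi_le
    (by linarith [hu.2, h.hi_le_right])
    (by linarith [hu.1, h.lo_pos, h.right_le, h.lo_le])
  nlinarith [h.legOne_pos hu]

/-- The short side next to a long side of slope `t ≥ x₂` in a fan spans a smaller height. -/
theorem legTwo_le_sin (h : SlopeRange N x₁ x₂ lo hi) {u : ℝ} (hu : u ∈ Set.Icc lo hi) {t : ℝ}
    (ht : x₂ ≤ t) (ht' : t ≤ 2 * lo) : legTwo x₁ x₂ * Real.sin (t + x₁) ≤ Real.sin t := by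
  have d := leg_decomposition (h.sin_add_pos hu).ne' t
  have : 0 ≤ Real.sin (t - x₂) := Real.sin_nonneg_of_nonneg_of_le_pi
    (by linarith) (by linarith [h.symm.left_pos hu, h.lo_pos, h.lo_le])
  nlinarith [h.legOne_pos hu]

end SlopeRange

/-- Height of the `j`-th upper vertex of a zigzag for fans with `2 * N` triangles around the vertex
with the angle `x`: the initial upper vertex has height `Y`, the `i`-th ascending long side has the
slope `u + i * μ`, and the descending long side after it has the slope
`π - 2 * N * x - (u + i * μ)`. -/
noncomputable def zigHeight (N : ℕ) (x u μ Y : ℝ) (j : ℕ) : ℝ :=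
  Y + ∑ i ∈ Finset.range j,
    (Real.sin (u + (i + 1) * μ) - Real.sin (Real.pi - 2 * N * x - (u + i * μ)))

theorem zigHeight_zero (N : ℕ) (x u μ Y : ℝ) : zigHeight N x u μ Y 0 = Y := by
  simp [zigHeight]

theorem zigHeight_succ (N : ℕ) (x u μ Y : ℝ) (j : ℕ) : zigHeight N x u μ Y (j + 1) =
    zigHeight N x u μ Y j +
      (Real.sin (u + (j + 1) * μ) - Real.sin (Real.pi - 2 * N * x - (u + j * μ))) := by
  rw [zigHeight, zigHeight, Finset.sum_range_succ, add_assoc]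

section
variable {N : ℕ} {x₁ x₂ lo hi : ℝ}

/-- Descending sides are steeper than ascending ones. -/
theorem SlopeRange.sin_le_sin_down (h : SlopeRange N x₁ x₂ lo hi) {u v : ℝ}
    (hu : u ∈ Set.Icc lo hi) (hv : v ∈ Set.Icc lo hi) :
    Real.sin v ≤ Real.sin (Real.pi - 2 * N * x₁ - u) :=
  sin_le_sin_of_mem (by linarith [hv.1, h.lo_pos])
    (by linarith [hu.2, hv.2, h.add_hi_le, h.hi_le_left])
    (by linarith [hu.1, hv.2, h.le_lo, h.lo_le, h.hi_le_left, h.left_le, h.lo_pos])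

/-- One round of a zigzag, consisting of a fan around the vertex `1` and one around the
vertex `2`. -/
theorem follows_round (h : SlopeRange N x₁ x₂ lo hi) {u Y : ℝ}
    (hu : u ∈ Set.Icc lo hi) (hu' : u + 2 * N * (x₁ - x₂) ∈ Set.Icc lo hi) (hY : 0 < Y)
    (hYu : Y < Real.sin u)
    (hY' : 0 < Y + (Real.sin (u + 2 * N * (x₁ - x₂)) - Real.sin (Real.pi - 2 * N * x₁ - u))) :
    Follows x₁ x₂ (wordPow [2, 3] N ++ wordPow [1, 3] N) (sight (Real.pi - u) Y)
      (sight (Real.pi - (u + 2 * N * (x₁ - x₂)))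
        (Y + (Real.sin (u + 2 * N * (x₁ - x₂)) - Real.sin (Real.pi - 2 * N * x₁ - u)))) := by
  have hw := h.sin_le_sin_down hu hu
  have h1 := h.left_pos hu
  have h2 := h.symm.left_pos hu
  have hlo := h.lo_pos
  have a1 : Follows x₁ x₂ (wordPow [2, 3] N) (sight (Real.pi - u) Y)
      (sight (Real.pi - 2 * N * x₁ - u) Y) :=
    follows_fan (ν := u) (κ := u + x₁) h1.le (h.legTwo_pos hu).le hY (by linarith [hu.1])
      (by linarith [hu.1]) hYu (hYu.trans_le (h.sin_le_legTwo hu))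
      (by linarith [hu.2, h.add_hi_le, h.hi_le_left])
      (by linarith [hu.2, h.add_hi_le, h.hi_le_left]) N le_rfl le_rfl (by ring)
  have hZ : Real.sin (Real.pi - 2 * N * x₁ - u) - Y < Real.sin (u + 2 * N * (x₁ - x₂)) := by
    linarith
  have a2 := follows_fan_mirror (p := Real.pi - 2 * N * x₁ - u) (r := u + 2 * N * (x₁ - x₂))
      (ν := u + 2 * N * (x₁ - x₂)) (κ := u + 2 * N * (x₁ - x₂) + x₂)
      (Z := Real.sin (Real.pi - 2 * N * x₁ - u) - Y) (h.sin_add_pos hu).ne' h2.le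
      (h.legOne_pos hu).le (by linarith) (by linarith [hu'.1]) (by linarith [hu'.1]) hZ
      (by rw [← legTwo_swap]; exact hZ.trans_le (h.symm.sin_le_legTwo hu')) le_rfl le_rfl N
      (by linarith [hu.2, hu'.2, h.add_hi_le, h.hi_le_left])
      (by linarith [hu.2, hu'.2, h.add_hi_le, h.hi_le_left]) (by ring)
  rw [sub_sub_cancel] at a2
  convert a1.append a2 using 2
  ring

/-- Along a zigzag the vertices descend on both sides of the line of flight. So they stay on the
correct side if the first lower vertex and the last upper vertex do. -/
theorem follows_zigzag (h : SlopeRange N x₁ x₂ lo hi) {u Y : ℝ} (m : ℕ)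
    (hu : ∀ j : ℕ, j ≤ m → u + j * (2 * N * (x₁ - x₂)) ∈ Set.Icc lo hi)
    (hYu : Y < Real.sin u) (hY : 0 < zigHeight N x₁ u (2 * N * (x₁ - x₂)) Y m) :
    Follows x₁ x₂ (wordPow (wordPow [2, 3] N ++ wordPow [1, 3] N) m) (sight (Real.pi - u) Y)
      (sight (Real.pi - (u + m * (2 * N * (x₁ - x₂))))
        (zigHeight N x₁ u (2 * N * (x₁ - x₂)) Y m)) ∧
    zigHeight N x₁ u (2 * N * (x₁ - x₂)) Y m < Real.sin (u + m * (2 * N * (x₁ - x₂))) := by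
  induction m with
  | zero =>
    simp only [zigHeight_zero, Nat.cast_zero, zero_mul, add_zero]
    exact ⟨rfl, hYu⟩
  | succ m ih =>
    have hm := hu m (Nat.le_succ m)
    have hm' := hu (m + 1) le_rfl
    rw [zigHeight_succ] at hY ⊢
    push_cast at hm' hY ⊢
    have hw := h.sin_le_sin_down hm hm'
    have hw2 := h.sin_le_sin_down hm hm
    obtain ⟨i1, i2⟩ := ih (fun j hj => hu j (hj.trans (Nat.le_succ m))) (by linarith)
    refine ⟨?_, by linarith⟩
    rw [wordPow_succ']
    have e : u + ((m : ℝ) + 1) * (2 * N * (x₁ - x₂))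
      = u + m * (2 * N * (x₁ - x₂)) + 2 * N * (x₁ - x₂) := by ring
    rw [e] at hY hm' hw ⊢
    exact i1.append (follows_round h hm hm' (by linarith) i2 (by linarith))

/-- The word of a zigzag of `k` rounds that leads through a shortened fan around the vertex `2` and
a corner to another fan around the vertex `1`. -/
def wordShort (N k : ℕ) : List (Fin 3) :=
  wordPow (wordPow [2, 3] N ++ wordPow [1, 3] N) k ++ wordPow [2, 3] N ++ wordPow [1, 3] (N - 1)
    ++ [1, 2, 3] ++ wordPow [2, 3] N

/-- The word of a zigzag of `k` rounds that leads through a corner and a shortened fan around the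
vertex `2` to another fan around the vertex `1`. -/
def wordLong (N k : ℕ) : List (Fin 3) :=
  wordPow (wordPow [2, 3] N ++ wordPow [1, 3] N) k ++ wordPow [2, 3] N ++ [2, 1, 3]
    ++ wordPow [1, 3] (N - 1) ++ wordPow [2, 3] N

/-- The critical vertex is the last upper vertex of the zigzag continued by one round. It has to
lie below the line of flight, but the short side issuing from it has to end above the line. -/
theorem follows_wordShort (hN : 1 ≤ N) (h : SlopeRange N x₁ x₂ lo hi) {u Y : ℝ} (k : ℕ)
    (hu : ∀ j : ℕ, j ≤ k + 1 → u + j * (2 * N * (x₁ - x₂)) ∈ Set.Icc lo hi)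
    {u' : ℝ} (hu' : u' ∈ Set.Icc lo hi)
    (hu'' : u' = u + (k + 1) * (2 * N * (x₁ - x₂)) + Real.pi - 2 * (N + 1) * x₁)
    (hYu : Y < Real.sin u)
    (hH : zigHeight N x₁ u (2 * N * (x₁ - x₂)) Y (k + 1) < 0)
    (hH' : -(legTwo x₁ x₂ * Real.sin (x₁ - (u + (k + 1) * (2 * N * (x₁ - x₂))))) <
      zigHeight N x₁ u (2 * N * (x₁ - x₂)) Y (k + 1)) :
    Follows x₁ x₂ (wordShort N k) (sight (Real.pi - u) Y)
      (sight u' (-zigHeight N x₁ u (2 * N * (x₁ - x₂)) Y (k + 1))) := by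
  have hk := hu k (Nat.le_succ k)
  have hk' := hu (k + 1) le_rfl
  push_cast at hk'
  set μ := 2 * N * (x₁ - x₂) with hμ
  have eu : u + ((k : ℝ) + 1) * μ = u + k * μ + μ := by ring
  rw [zigHeight_succ] at hH hH' ⊢
  rw [eu] at hk' hu'' hH' hH ⊢
  set v := u + k * μ with hv
  set v' := v + μ with hv'
  set w := Real.pi - 2 * N * x₁ - v with hw
  set Yk := zigHeight N x₁ u μ Y k with hYk
  have h1 := h.left_pos hk
  have h2 := h.symm.left_pos hk
  have hs := (h.sin_add_pos hk).ne'
  have hl1 := h.legOne_pos hk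
  have hl2 := h.legTwo_pos hk
  have d := leg_decomposition (h.symm.sin_add_pos hk).ne' v'
  rw [legTwo_swap x₁ x₂, legOne_swap x₁ x₂, show v' - x₁ = -(x₁ - v') by ring, Real.sin_neg] at d
  have hwlo : x₂ ≤ w := by linarith [hk.2, h.cross_add_hi_le']
  have hwlo' : x₁ ≤ w := by linarith [hk.2, h.add_hi_le]
  have hwhi : w ≤ 2 * lo := by linarith [hk.1, h.le_lo]
  -- Depth of the last lower vertex of the zigzag.
  set Z := Real.sin w - Yk with hZ
  have hv'sin : 0 ≤ Real.sin v' := Real.sin_nonneg_of_nonneg_of_le_pi (by linarith [hk'.1])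
    (by linarith [hk'.2, h.hi_le_left, h.left_le, h.lo_le])
  have hZ0 : 0 < Z := by linarith
  have hZκ : Z < legOne x₁ x₂ * Real.sin (v' + x₂) := by linarith
  have hZw : Z < Real.sin w := by
    refine hZκ.trans_le (le_trans ?_ (legTwo_swap x₁ x₂ ▸ h.symm.legTwo_le_sin hk hwlo' hwhi))
    exact mul_le_mul_of_nonneg_left (sin_le_sin_of_mem (by linarith [hk'.1])
      (by linarith [hk'.2, h.hi_le_right])
      (by linarith [hk'.2, h.hi_le_right, h.right_le, h.lo_le])) hl1.le
  obtain ⟨z1, z2⟩ := follows_zigzag h k (fun j hj => hu j (hj.trans (Nat.le_succ k))) hYu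
    (by linarith)
  have a1 : Follows x₁ x₂ (wordPow [2, 3] N) (sight (Real.pi - v) Yk) (sight w Yk) :=
    follows_fan (ν := v) (κ := v + x₁) h1.le hl2.le (by linarith) (by linarith [hk.1])
      (by linarith [hk.1]) z2 (z2.trans_le (h.sin_le_legTwo hk))
      (by linarith [hk.2, h.hi_le_left]) (by linarith [hk.2, h.hi_le_left]) N le_rfl le_rfl
      (by rw [hw]; ring)
  have a2 := follows_fan_mirror (p := w) (r := v' + 2 * x₂) (ν := w) (κ := v' + x₂) (Z := Z) hs
    h2.le hl1.le hZ0 (by linarith) (by linarith [hk'.1]) hZw hZκ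
    (by linarith [hk'.1, hk'.2, h.hi_le_right]) (by linarith) (N - 1) le_rfl
    (by linarith [hk'.2, h.hi_le_right])
    (by rw [hw, hv', hμ, Nat.cast_sub hN]; push_cast; ring)
  rw [hZ, sub_sub_cancel, ← hZ] at a2
  have eY : Z - Real.sin (v' + 2 * x₂ - 2 * x₂) = -(Yk + (Real.sin v' - Real.sin w)) := by
    rw [show v' + 2 * x₂ - 2 * x₂ = v' by ring]; ring
  have ep : 2 * x₁ + 2 * x₂ - (v' + 2 * x₂) = 2 * x₁ - v' := by ring
  have hsmall : -(Yk + (Real.sin v' - Real.sin w)) < Real.sin (x₁ - v') := by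
    have : 0 ≤ Real.sin (x₁ - v') := Real.sin_nonneg_of_nonneg_of_le_pi
      (by linarith [hk'.2, h.hi_le_left]) (by linarith [hk'.1, h.left_le, h.lo_le])
    nlinarith [h.legTwo_le_one hk]
  have hu'sin : -(Yk + (Real.sin v' - Real.sin w)) < Real.sin u' :=
    hsmall.trans_le (sin_le_sin_of_mem (by linarith [hk'.2, h.hi_le_left])
      (by linarith [hk'.1, hu'.1, h.left_le])
      (by linarith [hu'.2, hk'.1, h.hi_le_left, h.left_le, h.lo_le]))
  have a3 := follows_corner (x₁ := x₁) (x₂ := x₂) (q := v' + 2 * x₂) (Z := Z) hs hZ0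
    (by rw [show v' + 2 * x₂ - x₂ = v' + x₂ by ring]; exact hZκ)
    (by rw [eY]; linarith)
    (by
      rw [eY, ep]
      exact hsmall.trans_le (sin_le_sin_of_mem (by linarith [hk'.2, h.hi_le_left])
        (by linarith) (by linarith [hk'.1, h.left_le, h.lo_le])))
  rw [eY, ep] at a3
  have a4 : Follows x₁ x₂ (wordPow [2, 3] N)
      (sight (Real.pi - (2 * x₁ - v')) (-(Yk + (Real.sin v' - Real.sin w))))
      (sight u' (-(Yk + (Real.sin v' - Real.sin w)))) :=
    follows_fan (ν := u') (κ := u' + x₁) h1.le hl2.le (by linarith) (by linarith [hu'.1])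
      (by linarith [hu'.1]) hu'sin (hu'sin.trans_le (h.sin_le_legTwo hu')) le_rfl le_rfl N
      (by linarith [hk'.2, hu'.2, h.hi_le_left]) (by linarith [hk'.2, hu'.2, h.hi_le_left])
      (by rw [hu'']; ring)
  exact (((z1.append a1).append a2).append a3).append a4

/-- The critical vertex is the last upper vertex of the zigzag. It has to lie above the line of
flight, but the short side issuing from it has to end below the line. -/
theorem follows_wordLong (hN : 1 ≤ N) (h : SlopeRange N x₁ x₂ lo hi) {u Y : ℝ} (k : ℕ)
    (hu : ∀ j : ℕ, j ≤ k → u + j * (2 * N * (x₁ - x₂)) ∈ Set.Icc lo hi)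
    {u' : ℝ} (hu' : u' ∈ Set.Icc lo hi) (hu'₁ : u' - 2 * N * (x₁ - x₂) ∈ Set.Icc lo hi)
    (hu'' : u' = u + k * (2 * N * (x₁ - x₂)) + 2 * (N + 1) * x₁ - Real.pi)
    (hYu : Y < Real.sin u)
    (hH : 0 < zigHeight N x₁ u (2 * N * (x₁ - x₂)) Y k)
    (hH' : zigHeight N x₁ u (2 * N * (x₁ - x₂)) Y k < legTwo x₁ x₂ * Real.sin (x₁ - u')) :
    Follows x₁ x₂ (wordLong N k) (sight (Real.pi - u) Y)
      (sight (u' - 2 * N * (x₁ - x₂)) (Real.sin (Real.pi - 2 * N * x₂ - u') - Real.sin u' -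
        zigHeight N x₁ u (2 * N * (x₁ - x₂)) Y k)) ∧
    0 < Real.sin (Real.pi - 2 * N * x₂ - u') - Real.sin u' -
        zigHeight N x₁ u (2 * N * (x₁ - x₂)) Y k := by
  have hk := hu k le_rfl
  obtain ⟨z1, z2⟩ := follows_zigzag h k hu hYu hH
  set μ := 2 * N * (x₁ - x₂) with hμ
  set v := u + k * μ with hv
  set w := Real.pi - 2 * N * x₁ - v with hw
  set w' := Real.pi - 2 * N * x₂ - u' with hw'
  set H := zigHeight N x₁ u μ Y k with hHdef
  have h1 := h.left_pos hk
  have h2 := h.symm.left_pos hk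
  have hs := (h.sin_add_pos hk).ne'
  have hl1 := h.legOne_pos hk
  have hl2 := h.legTwo_pos hk
  have hwu : w = 2 * x₁ - u' := by rw [hw, hu'']; ring
  have d := leg_decomposition (h.symm.sin_add_pos hk).ne' u'
  rw [legTwo_swap x₁ x₂, legOne_swap x₁ x₂, show u' - x₁ = -(x₁ - u') by ring, Real.sin_neg] at d
  have hwlo' : x₁ ≤ w' := by linarith [hu'.2, h.cross_add_hi_le]
  have hwhi : w' ≤ 2 * lo := by linarith [hu'.1, h.le_lo']
  have hZκ : H + Real.sin u' < legOne x₁ x₂ * Real.sin (u' + x₂) := by linarith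
  have hZw : H + Real.sin u' < Real.sin w' := by
    refine hZκ.trans_le (le_trans ?_ (legTwo_swap x₁ x₂ ▸ h.symm.legTwo_le_sin hk hwlo' hwhi))
    exact mul_le_mul_of_nonneg_left (sin_le_sin_of_mem (by linarith [hu'.1])
      (by linarith [hu'.2, h.hi_le_left])
      (by linarith [hu'.2, h.hi_le_right, h.right_le, h.lo_le])) hl1.le
  have hu'sin : 0 ≤ Real.sin u' := Real.sin_nonneg_of_nonneg_of_le_pi (by linarith [hu'.1])
    (by linarith [hu'.2, h.hi_le_left, h.left_le, h.lo_le])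
  refine ⟨?_, by linarith⟩
  have a1 : Follows x₁ x₂ (wordPow [2, 3] N) (sight (Real.pi - v) H) (sight w H) :=
    follows_fan (ν := v) (κ := v + x₁) h1.le hl2.le (by linarith) (by linarith [hk.1])
      (by linarith [hk.1]) z2 (z2.trans_le (h.sin_le_legTwo hk))
      (by linarith [hk.2, h.hi_le_left, h.add_hi_le])
      (by linarith [hk.2, h.hi_le_left, h.add_hi_le]) N le_rfl le_rfl (by rw [hw]; ring)
  have e1 : H - Real.sin (w - 2 * x₁) = H + Real.sin u' := by
    rw [hwu, show 2 * x₁ - u' - 2 * x₁ = -u' by ring, Real.sin_neg]; ring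
  have ep : 2 * x₁ + 2 * x₂ - w = u' + 2 * x₂ := by rw [hwu]; ring
  have hwp : w' ≤ u' + 2 * x₂ := by linarith [hu'.1, hu'.2, h.hi_le_right]
  have a2 := follows_corner_mirror (x₁ := x₁) (x₂ := x₂) (q := w) (Y := H) hs hH
    (by rw [hwu, show 2 * x₁ - u' - x₁ = x₁ - u' by ring]; exact hH')
    (by rw [e1]; linarith)
    (by
      rw [e1, ep]
      exact hZw.trans_le (sin_le_sin_of_mem (by linarith) hwp
        (by linarith [hu'.2, h.hi_le_right, h.right_le, h.lo_le])))
  rw [e1, ep] at a2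
  have a3 := follows_fan_mirror (p := u' + 2 * x₂) (r := w') (ν := w') (κ := u' + x₂)
    (Z := H + Real.sin u') hs h2.le hl1.le (by linarith) (by linarith) (by linarith [hu'.1]) hZw
    hZκ le_rfl (by linarith [hu'.2, h.hi_le_left]) (N - 1) hwp (by linarith)
    (by rw [hw', Nat.cast_sub hN]; push_cast; ring)
  have hN1 : Real.sin w' ≤ Real.sin u' + Real.sin (u' - μ) := by
    have h3 : Real.sin w' ≤ Real.sin (u' + (u' - μ)) := sin_le_sin_of_mem (by linarith)
      (by linarith [hu'.1, hu'₁.1])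
      (by linarith [hu'.2, hu'₁.2, h.hi_le_left, h.left_le, h.lo_le])
    have h4 : 0 ≤ Real.sin (u' - μ) := Real.sin_nonneg_of_nonneg_of_le_pi (by linarith [hu'₁.1])
      (by linarith [hu'₁.2, h.hi_le_left, h.left_le, h.lo_le])
    rw [Real.sin_add] at h3
    nlinarith [Real.cos_le_one u', Real.cos_le_one (u' - μ)]
  have hYu' : Real.sin w' - (H + Real.sin u') < Real.sin (u' - μ) := by linarith
  have a4 : Follows x₁ x₂ (wordPow [2, 3] N)
      (sight (Real.pi - w') (Real.sin w' - (H + Real.sin u')))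
      (sight (u' - μ) (Real.sin w' - (H + Real.sin u'))) :=
    follows_fan (ν := u' - μ) (κ := u' - μ + x₁) h1.le hl2.le (by linarith) (by linarith [hu'₁.1])
      (by linarith [hu'₁.1]) hYu' (hYu'.trans_le (h.sin_le_legTwo hu'₁)) le_rfl le_rfl N
      (by linarith [hu'₁.2, h.hi_le_left]) (by linarith [hu'₁.2, h.hi_le_left])
      (by rw [hw', hμ]; ring)
  rw [show Real.sin w' - Real.sin u' - H = Real.sin w' - (H + Real.sin u') by ring]
  exact (((z1.append a1).append a2).append a3).append a4

end

/-! ### The four zigzags of the tile word -/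

/-- Height gained along a zigzag of `m` rounds that begins and ends with an ascending side. -/
noncomputable def zigRise (N : ℕ) (x u μ : ℝ) (m : ℕ) : ℝ :=
  Real.sin (u + m * μ) + ∑ i ∈ Finset.range m,
    (Real.sin (u + i * μ) - Real.sin (Real.pi - 2 * N * x - (u + i * μ)))

theorem zigHeight_add_sin (N : ℕ) (x u μ c : ℝ) (m : ℕ) :
    zigHeight N x u μ (c + Real.sin u) m = c + zigRise N x u μ m := by
  induction m with
  | zero => simp [zigHeight, zigRise]
  | succ m ih =>
    rw [zigHeight_succ, ih, zigRise, zigRise, Finset.sum_range_succ]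
    push_cast
    ring

theorem zigHeight_shift (N : ℕ) (x u μ c : ℝ) (m : ℕ) :
    zigHeight N x (u + μ) μ (c + Real.sin u - Real.sin (Real.pi - 2 * N * x - u) +
      Real.sin (u + μ)) m = c + zigRise N x u μ (m + 1) := by
  rw [zigHeight_add_sin, zigRise, zigRise, Finset.sum_range_succ']
  push_cast
  rw [show u + μ + m * μ = u + (m + 1) * μ by ring,
    Finset.sum_congr rfl (fun i _ => by rw [show u + μ + (i : ℝ) * μ = u + (i + 1) * μ by ring])]
  simp only [zero_mul, add_zero]
  ring

/-- Up to rotation, the tile word consists of four zigzags with their corners. -/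
theorem tileWord_rotate (N k : ℕ) (hN : 1 ≤ N) : ∃ u v : List (Fin 3),
    tileWord (N + 1) k = u ++ v ∧
    v ++ u = wordShort N k ++ swapWord (wordShort N k) ++ wordLong N k ++
      swapWord (wordLong N k) := by
  obtain ⟨N, rfl⟩ : ∃ N', N = N' + 1 := ⟨N - 1, by omega⟩
  have s1 : swapWord [2, 3] = [1, 3] := rfl
  have s2 : swapWord [1, 3] = [2, 3] := rfl
  have s3 : swapWord [1, 2, 3] = [2, 1, 3] := rfl
  have s4 : swapWord [2, 1, 3] = [1, 2, 3] := rfl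
  refine ⟨wordPow [2, 3] (N + 1) ++ wordPow [1, 3] (N + 1),
    wordPow (wordPow [2, 3] (N + 1) ++ wordPow [1, 3] (N + 1)) k ++ wordPow [2, 3] (N + 1) ++
      wordPow [1, 3] N ++ [1] ++ wordPow [2, 3] (N + 2) ++
      wordPow (wordPow [1, 3] (N + 1) ++ wordPow [2, 3] (N + 1)) k ++ wordPow [1, 3] (N + 1) ++
      wordPow [2, 3] N ++ [2] ++ wordPow [1, 3] (N + 2) ++
      wordPow (wordPow [2, 3] (N + 1) ++ wordPow [1, 3] (N + 1)) k ++ wordPow [2, 3] (N + 1) ++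
      [2] ++ wordPow (wordPow [1, 3] (N + 1) ++ wordPow [2, 3] (N + 1)) (k + 1) ++
      wordPow [1, 3] (N + 1) ++ [1], ?_, ?_⟩
  · simp [tileWord, wordPow_succ]
  · simp only [wordShort, wordLong, swapWord_append, swapWord_wordPow, s1, s2, s3, s4]
    simp [wordPow_succ]

/-- The tile word is realized if the four critical vertices, whose heights are `O`, `P`, `Q`, `R`,
lie on the correct side of the line of flight and the short sides issuing from them cross the line.
The zigzag between two critical vertices is the one whose first ascending side has the slope
`u₀`, `u₁`, `u₂`, `u₃` respectively; `hO` says that the path closes up. -/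
theorem mem_orbitTile_of_zigRise {N k : ℕ} (hN : 1 ≤ N) {X : Plane} (hX : X ∈ paramSpace)
    {x₁ x₂ μ lo hi : ℝ} (hX₀ : X 0 = x₁) (hX₁ : X 1 = x₂) (hμ : μ = 2 * N * (x₁ - x₂))
    (h : SlopeRange N x₁ x₂ lo hi) {u₀ u₁ u₂ u₃ O P Q R : ℝ}
    (hu₁ : u₁ = u₀ + (k + 2) * μ + Real.pi - 2 * (N + 1) * x₁)
    (hu₂ : u₂ = u₁ + (k + 1) * -μ + Real.pi - 2 * (N + 1) * x₂)
    (hu₃ : u₃ = u₂ + k * μ + 2 * (N + 1) * x₁ - Real.pi)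
    (r₀ : ∀ j : ℕ, j ≤ k + 2 → u₀ + j * μ ∈ Set.Icc lo hi)
    (r₁ : ∀ j : ℕ, j ≤ k + 1 → u₁ + j * -μ ∈ Set.Icc lo hi)
    (r₂ : ∀ j : ℕ, j ≤ k → u₂ + j * μ ∈ Set.Icc lo hi)
    (r₃ : ∀ j : ℕ, j ≤ k + 1 → u₃ + j * -μ ∈ Set.Icc lo hi)
    (hP : P = O + zigRise N x₁ u₀ μ (k + 2))
    (hQ : Q = P + zigRise N x₂ u₁ (-μ) (k + 1))
    (hR : R = Q + zigRise N x₁ u₂ μ k)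
    (hO : O = R + zigRise N x₂ u₃ (-μ) (k + 1))
    (P_neg : P < 0) (Q_neg : Q < 0) (R_pos : 0 < R) (O_pos : 0 < O)
    (lt_P : -(legTwo x₁ x₂ * Real.sin (x₁ - (u₀ + (k + 2) * μ))) < P)
    (lt_Q : -(legOne x₁ x₂ * Real.sin (x₂ - (u₁ + (k + 1) * -μ))) < Q)
    (R_lt : R < legTwo x₁ x₂ * Real.sin (x₁ - u₃))
    (O_lt : O < legOne x₁ x₂ * Real.sin (x₂ - u₀)) :
    X ∈ orbitTile (tileWord (N + 1) k) := by
  have hneg' : -μ = 2 * N * (x₂ - x₁) := by rw [hμ]; ring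
  rw [hneg'] at hu₂ r₁ r₃ hQ hO lt_Q
  subst hμ
  obtain ⟨w, w', hw, hw'⟩ := tileWord_rotate N k hN
  have hneg : 2 * (N : ℝ) * (x₂ - x₁) = -(2 * N * (x₁ - x₂)) := by ring
  have m₀ : u₀ ∈ Set.Icc lo hi := by simpa using r₀ 0 (by omega)
  have m₀' : u₀ + 2 * N * (x₁ - x₂) ∈ Set.Icc lo hi := by simpa using r₀ 1 (by omega)
  have m₁ : u₁ ∈ Set.Icc lo hi := by simpa using r₁ 0 (by omega)
  have m₂ : u₂ ∈ Set.Icc lo hi := by simpa using r₂ 0 (by omega)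
  have m₃ : u₃ ∈ Set.Icc lo hi := by simpa using r₃ 0 (by omega)
  have m₃' : u₃ + 2 * N * (x₂ - x₁) ∈ Set.Icc lo hi := by simpa using r₃ 1 (by omega)
  have hx := (h.sin_add_pos m₀).ne'
  have e1 : zigHeight N x₂ u₁ (2 * N * (x₂ - x₁)) (P + Real.sin u₁) (k + 1) = Q := by
    rw [zigHeight_add_sin, hQ]
  have e2 : zigHeight N x₁ u₂ (2 * N * (x₁ - x₂)) (Q + Real.sin u₂) k = R := by
    rw [zigHeight_add_sin, hR]
  have e0 : zigHeight N x₁ (u₀ + 2 * N * (x₁ - x₂)) (2 * N * (x₁ - x₂))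
      (O + Real.sin u₀ - Real.sin (Real.pi - 2 * N * x₁ - u₀) +
        Real.sin (u₀ + 2 * N * (x₁ - x₂))) (k + 1) = P := by
    rw [zigHeight_shift, hP]
  have e3 : zigHeight N x₂ (u₃ + 2 * N * (x₂ - x₁)) (2 * N * (x₂ - x₁))
      (R + Real.sin u₃ - Real.sin (Real.pi - 2 * N * x₂ - u₃) +
        Real.sin (u₃ + 2 * N * (x₂ - x₁))) k = O := by
    rw [zigHeight_shift, hO]
  -- The third and the fourth zigzag come first: they provide the bounds at the start of the
  -- fourth and of the first one.
  obtain ⟨f₂, g₂⟩ := follows_wordLong hN h (Y := Q + Real.sin u₂) k r₂ m₃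
    (by rw [show 2 * (N : ℝ) * (x₁ - x₂) = -(2 * N * (x₂ - x₁)) by ring, sub_neg_eq_add]
        exact m₃') hu₃ (by linarith) (by rw [e2]; exact R_pos) (by rw [e2]; exact R_lt)
  rw [e2] at f₂ g₂
  obtain ⟨f₃, g₃⟩ := follows_wordLong hN h.symm (u := u₃ + 2 * N * (x₂ - x₁))
    (Y := R + Real.sin u₃ - Real.sin (Real.pi - 2 * N * x₂ - u₃) +
        Real.sin (u₃ + 2 * N * (x₂ - x₁))) k
    (fun j hj => by
      have := r₃ (j + 1) (by omega)
      push_cast at this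
      convert this using 1; ring)
    m₀ (by rw [hneg, sub_neg_eq_add]; exact m₀')
    (by rw [hu₃, hu₂, hu₁]; ring)
    (by linarith) (by rw [e3]; exact O_pos) (by rw [e3, legTwo_swap]; exact O_lt)
  rw [e3] at f₃ g₃
  have f₀ := follows_wordShort hN h (u := u₀ + 2 * N * (x₁ - x₂))
    (Y := O + Real.sin u₀ - Real.sin (Real.pi - 2 * N * x₁ - u₀) +
        Real.sin (u₀ + 2 * N * (x₁ - x₂))) k
    (fun j hj => by
      have := r₀ (j + 1) (by omega)
      push_cast at this
      convert this using 1; ring)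
    m₁ (by rw [hu₁]; ring) (by linarith) (by rw [e0]; exact P_neg)
    (by
      rw [e0]
      convert lt_P using 5
      ring)
  rw [e0] at f₀
  have f₁ := (follows_wordShort hN h.symm (u := u₁) (Y := P + Real.sin u₁) k r₁ m₂ hu₂
    (by linarith) (by rw [e1]; exact Q_neg)
    (by rw [e1, legTwo_swap]; exact lt_Q)).mirror_sight hx
  rw [e1] at f₁
  have f₃' := f₃.mirror_sight hx
  have c₁ : sight (Real.pi - (Real.pi - u₁)) (Real.sin (Real.pi - u₁) - (P + Real.sin u₁))
      = sight u₁ (-P) := by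
    rw [Real.sin_pi_sub]; exact congrArg₂ sight (by ring) (by ring)
  have c₂ : sight (Real.pi - u₂) (Real.sin u₂ - -Q)
      = sight (Real.pi - u₂) (Q + Real.sin u₂) :=
    congrArg₂ sight rfl (by ring)
  have c₃ : sight (Real.pi - (Real.pi - (u₃ + 2 * N * (x₂ - x₁))))
        (Real.sin (Real.pi - (u₃ + 2 * N * (x₂ - x₁))) -
          (R + Real.sin u₃ - Real.sin (Real.pi - 2 * N * x₂ - u₃) +
            Real.sin (u₃ + 2 * N * (x₂ - x₁))))
      = sight (u₃ - 2 * N * (x₁ - x₂))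
        (Real.sin (Real.pi - 2 * N * x₂ - u₃) - Real.sin u₃ - R) := by
    rw [Real.sin_pi_sub]; exact congrArg₂ sight (by ring) (by ring)
  have c₄ : sight (Real.pi - (u₀ - 2 * N * (x₂ - x₁))) (Real.sin (u₀ - 2 * N * (x₂ - x₁)) -
        (Real.sin (Real.pi - 2 * N * x₁ - u₀) - Real.sin u₀ - O))
      = sight (Real.pi - (u₀ + 2 * N * (x₁ - x₂)))
        (O + Real.sin u₀ - Real.sin (Real.pi - 2 * N * x₁ - u₀) +
          Real.sin (u₀ + 2 * N * (x₁ - x₂))) := by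
    rw [show u₀ - 2 * N * (x₂ - x₁) = u₀ + 2 * N * (x₁ - x₂) by ring]
    exact congrArg₂ sight rfl (by ring)
  rw [c₁, c₂] at f₁
  rw [c₃, c₄] at f₃'
  have hall := ((f₀.append f₁).append f₂).append f₃'
  rw [← hw'] at hall
  obtain ⟨t, t1, t2⟩ := hall.exists_of_append
  rw [hw]
  refine mem_orbitTile_of_follows hX (s := t) ?_ (by rw [hX₀, hX₁]; exact t2.append t1)
  intro hnil
  have := congrArg List.length hw
  rw [hnil] at this
  simp [tileWord] at this

/-! ### First order expansions near the Veech point -/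

theorem abs_sin_add_sub_le {γ a : ℝ} (ha : |a| ≤ 1) :
    |Real.sin (γ + a) - (Real.sin γ + Real.cos γ * a)| ≤ |a| ^ 2 := by
  have h1 : |1 - Real.cos a| ≤ |a| ^ 2 / 2 := by
    rw [abs_of_nonneg (by linarith [Real.cos_le_one a]), sq_abs]
    linarith [Real.one_sub_sq_div_two_le_cos (x := a)]
  have h2 := Real.abs_sub_sin_le a
  have h3 : Real.sin (γ + a) - (Real.sin γ + Real.cos γ * a)
      = -(Real.sin γ * (1 - Real.cos a)) - Real.cos γ * (a - Real.sin a) := by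
    rw [Real.sin_add]; ring
  have h4 : |Real.sin γ * (1 - Real.cos a)| ≤ |a| ^ 2 / 2 := by
    rw [abs_mul]
    nlinarith [Real.abs_sin_le_one γ, abs_nonneg (1 - Real.cos a), abs_nonneg (Real.sin γ)]
  have h5 : |Real.cos γ * (a - Real.sin a)| ≤ |a| ^ 3 / 6 := by
    rw [abs_mul]
    nlinarith [Real.abs_cos_le_one γ, abs_nonneg (a - Real.sin a), abs_nonneg (Real.cos γ)]
  have h6 : |a| ^ 3 ≤ |a| ^ 2 := pow_le_pow_of_le_one (abs_nonneg a) ha (by norm_num)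
  rw [h3]
  calc _ ≤ |-(Real.sin γ * (1 - Real.cos a))| + |Real.cos γ * (a - Real.sin a)| := abs_sub _ _
    _ ≤ _ := by rw [abs_neg]; linarith [sq_nonneg |a|]

/-- The heights of an ascending side of slope `γ + a` and of the following descending side differ
by `2 * cos γ * (a + N * v)` up to terms of higher order. -/
theorem abs_sin_sub_sin_sub_le {N : ℕ} {γ v a B : ℝ} (hγ : 2 * (N + 1) * γ = Real.pi)
    (hv : 0 ≤ v) (hB : |a + N * v| ≤ B) :
    |Real.sin (γ + a) - Real.sin (Real.pi - 2 * N * (γ + v) - (γ + a)) -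
      2 * Real.cos γ * (a + N * v)| ≤ 2 * N * v * B + B ^ 3 / 3 := by
  have e : Real.sin (γ + a) - Real.sin (Real.pi - 2 * N * (γ + v) - (γ + a))
      = 2 * Real.cos (γ - N * v) * Real.sin (a + N * v) := by
    rw [Real.sin_sub_sin, show (γ + a - (Real.pi - 2 * N * (γ + v) - (γ + a))) / 2 = a + N * v by
        linear_combination hγ / 2,
      show (γ + a + (Real.pi - 2 * N * (γ + v) - (γ + a))) / 2 = γ - N * v by
        linear_combination -hγ / 2]
    ring
  set b := a + N * v
  have h1 : |Real.cos (γ - N * v) - Real.cos γ| ≤ N * v := by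
    refine (Real.abs_cos_sub_cos_le _ _).trans ?_
    rw [show γ - N * v - γ = -(N * v) by ring, abs_neg, abs_of_nonneg (by positivity)]
  have h2 : |Real.sin b| ≤ B := (Real.abs_sin_le_abs (x := b)).trans hB
  have h3 : |b - Real.sin b| ≤ B ^ 3 / 6 := (Real.abs_sub_sin_le b).trans (by gcongr)
  have e2 : 2 * Real.cos (γ - N * v) * Real.sin b - 2 * Real.cos γ * b
      = 2 * ((Real.cos (γ - N * v) - Real.cos γ) * Real.sin b) -
        2 * (Real.cos γ * (b - Real.sin b)) := by ring
  have h4 : |(Real.cos (γ - N * v) - Real.cos γ) * Real.sin b| ≤ N * v * B := by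
    rw [abs_mul]; gcongr
  have h5 : |Real.cos γ * (b - Real.sin b)| ≤ B ^ 3 / 6 := by
    rw [abs_mul]
    nlinarith [Real.abs_cos_le_one γ, abs_nonneg (b - Real.sin b), abs_nonneg (Real.cos γ)]
  rw [e, e2]
  calc _ ≤ |2 * ((Real.cos (γ - N * v) - Real.cos γ) * Real.sin b)| +
        |2 * (Real.cos γ * (b - Real.sin b))| := abs_sub _ _
    _ ≤ _ := by
      rw [abs_mul 2, abs_mul 2, abs_two]
      linarith

/-- First order expansion of the height gained along a zigzag of `m` rounds. -/
theorem abs_zigRise_sub_le {N m : ℕ} {γ v a μ δ : ℝ} (hγ : 2 * (N + 1) * γ = Real.pi)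
    (hv : 0 ≤ v) (hδ : 0 < δ) (hδ' : 6 * δ ≤ 1) (hNv : N * v ≤ δ ^ 2 / 2) (hm : m * δ ≤ 3)
    (ha : ∀ i : ℕ, i ≤ m → |a + i * μ| ≤ 5 * δ) :
    |zigRise N (γ + v) (γ + a) μ m -
      (Real.sin γ + Real.cos γ * ((2 * m + 1) * a + m ^ 2 * μ + 2 * m * (N * v)))|
      ≤ 300 * δ ^ 2 := by
  have hNv0 : 0 ≤ N * v := by positivity
  have hsum : ∀ j : ℕ, j ≤ m → |∑ i ∈ Finset.range j, (Real.sin (γ + a + i * μ) -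
      Real.sin (Real.pi - 2 * N * (γ + v) - (γ + a + i * μ))) -
      Real.cos γ * (2 * j * a + (j ^ 2 - j) * μ + 2 * j * (N * v))| ≤ j * (78 * δ ^ 3) := by
    intro j
    induction j with
    | zero => simp
    | succ j ih =>
      intro hj
      have h1 := ih (by omega)
      have hb : |a + j * μ + N * v| ≤ 6 * δ := by
        refine (abs_add_le _ _).trans ?_
        rw [abs_of_nonneg hNv0]
        nlinarith [ha j (by omega)]
      have h2 := abs_sin_sub_sin_sub_le hγ hv hb
      have h3 : 2 * N * v * (6 * δ) + (6 * δ) ^ 3 / 3 ≤ 78 * δ ^ 3 := by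
        nlinarith
      rw [Finset.sum_range_succ]
      push_cast
      rw [show γ + a + (j : ℝ) * μ = γ + (a + j * μ) by ring]
      have e : ∀ S T : ℝ, S + T - Real.cos γ * (2 * ((j : ℝ) + 1) * a +
          (((j : ℝ) + 1) ^ 2 - (j + 1)) * μ + 2 * (j + 1) * (N * v))
          = (S - Real.cos γ * (2 * j * a + (j ^ 2 - j) * μ + 2 * j * (N * v))) +
            (T - 2 * Real.cos γ * (a + j * μ + N * v)) := by
        intro S T; ring
      rw [e]
      refine (abs_add_le _ _).trans ?_
      linarith
  have h1 := hsum m le_rfl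
  have hm' := ha m le_rfl
  have h2 := abs_sin_add_sub_le (γ := γ) (a := a + m * μ) (by linarith)
  have h3 : |a + m * μ| ^ 2 ≤ 25 * δ ^ 2 := by
    calc |a + m * μ| ^ 2 ≤ (5 * δ) ^ 2 := by gcongr
      _ = _ := by ring
  unfold zigRise
  rw [show γ + a + (m : ℝ) * μ = γ + (a + m * μ) by ring]
  have e : ∀ S T : ℝ, S + T - (Real.sin γ + Real.cos γ * ((2 * (m : ℝ) + 1) * a + m ^ 2 * μ +
      2 * m * (N * v))) = (S - (Real.sin γ + Real.cos γ * (a + m * μ))) +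
      (T - Real.cos γ * (2 * m * a + ((m : ℝ) ^ 2 - m) * μ + 2 * m * (N * v))) := by
    intro S T; ring
  rw [e]
  refine (abs_add_le _ _).trans ?_
  have h4 : (m : ℝ) * (78 * δ ^ 3) ≤ 234 * δ ^ 2 := by
    have : (m : ℝ) * (78 * δ ^ 3) = (m * δ) * (78 * δ ^ 2) := by ring
    rw [this]
    nlinarith [sq_nonneg δ]
  linarith [sq_nonneg δ]

theorem continuous_zigRise (N m : ℕ) (x μ : ℝ) : Continuous fun u => zigRise N x u μ m := by
  unfold zigRise
  fun_prop

theorem abs_slope_le {Ω μ δ θ z : ℝ} {k : ℕ} (hk : 1 ≤ k) (hkδ : k * δ = 1) (hδ : 0 < δ)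
    (hΩ : |Ω| ≤ 2 * δ) (hμ : |μ| ≤ δ ^ 2) (hθ : |θ| ≤ (k + 2) / 2) (hz : 0 ≤ z)
    (hz' : z ≤ δ ^ 2) : |Ω + θ * μ - z| ≤ 5 * δ := by
  have hk' : (1 : ℝ) ≤ k := by exact_mod_cast hk
  have h1 : |θ * μ| ≤ 3 / 2 * δ := by
    rw [abs_mul]
    calc |θ| * |μ| ≤ (k + 2) / 2 * δ ^ 2 := by gcongr
      _ ≤ (3 * k) / 2 * δ ^ 2 := by gcongr; linarith
      _ = 3 / 2 * (k * δ) * δ := by ring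
      _ = _ := by rw [hkδ]; ring
  have h3 : |Ω + θ * μ - z| ≤ |Ω| + |θ * μ| + |z| :=
    (abs_sub _ _).trans (by linarith [abs_add_le Ω (θ * μ)])
  rw [abs_of_nonneg hz] at h3
  nlinarith

/-- First order expansions of the four gains in height. All slopes are expressed by the mean slope
`γ + Ω` of the ascending sides of the first zigzag; the relations between the zigzags at the corners
are built in. -/
theorem abs_zigRises_sub_le {N k : ℕ} {γ v₁ v₂ μ δ Ω : ℝ} (hγ : 2 * (N + 1) * γ = Real.pi)
    (h₁ : 0 ≤ v₁) (h₂ : 0 ≤ v₂) (hk : 1 ≤ k) (hkδ : k * δ = 1) (hδ : 0 < δ) (hδ' : 6 * δ ≤ 1)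
    (hv : 2 * (N + 1) * (v₁ + v₂) ≤ δ ^ 2) (hμ : μ = 2 * N * (v₁ - v₂)) (hΩ : |Ω| ≤ 2 * δ) :
    |zigRise N (γ + v₁) (γ + (Ω - (k + 2) * μ / 2)) μ (k + 2) - (Real.sin γ + Real.cos γ *
      ((2 * k + 5) * Ω + (k + 2) * N * (v₁ + v₂)))| ≤ 300 * δ ^ 2 ∧
    |zigRise N (γ + v₂) (γ + (Ω + (k + 2) * μ / 2 - 2 * (N + 1) * v₁)) (-μ) (k + 1) -
      (Real.sin γ + Real.cos γ * ((2 * k + 3) * Ω + (3 * k + 4) * N * (v₁ - v₂) -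
        2 * (N + 1) * (2 * k + 3) * v₁ + 2 * (k + 1) * N * v₂))| ≤ 300 * δ ^ 2 ∧
    |zigRise N (γ + v₁) (γ + (Ω - k * μ / 2 - 2 * (N + 1) * (v₁ + v₂))) μ k -
      (Real.sin γ + Real.cos γ * ((2 * k + 1) * Ω + k * N * (v₁ + v₂) -
        2 * (N + 1) * (2 * k + 1) * (v₁ + v₂)))| ≤ 300 * δ ^ 2 ∧
    |zigRise N (γ + v₂) (γ + (Ω + k * μ / 2 - 2 * (N + 1) * v₂)) (-μ) (k + 1) -
      (Real.sin γ + Real.cos γ * ((2 * k + 3) * Ω - (k + 2) * N * (v₁ - v₂) -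
        2 * (N + 1) * (2 * k + 3) * v₂ + 2 * (k + 1) * N * v₂))| ≤ 300 * δ ^ 2 := by
  have hμ' : |μ| ≤ δ ^ 2 := by
    rw [hμ, abs_le]
    constructor <;> nlinarith
  have hz₁ : 0 ≤ 2 * (N + 1) * v₁ := by positivity
  have hz₂ : 0 ≤ 2 * (N + 1) * v₂ := by positivity
  have b₁ : (N : ℝ) * v₁ ≤ δ ^ 2 / 2 := by nlinarith
  have b₂ : (N : ℝ) * v₂ ≤ δ ^ 2 / 2 := by nlinarith
  have key : ∀ θ z : ℝ, |θ| ≤ (k + 2) / 2 → 0 ≤ z → z ≤ δ ^ 2 → |Ω + θ * μ - z| ≤ 5 * δ :=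
    fun θ z hθ hz hz' => abs_slope_le hk hkδ hδ hΩ hμ' hθ hz hz'
  refine ⟨?_, ?_, ?_, ?_⟩
  · have h := abs_zigRise_sub_le (N := N) (m := k + 2) (γ := γ) (v := v₁)
      (a := Ω - (k + 2) * μ / 2) (μ := μ) hγ h₁ hδ hδ' b₁ (by push_cast; linarith)
      (fun i hi => by
        have hi' : (i : ℝ) ≤ k + 2 := by exact_mod_cast hi
        have hi0 : (0 : ℝ) ≤ i := Nat.cast_nonneg i
        convert key (i - (k + 2) / 2) 0 (abs_le.mpr ⟨by linarith, by linarith⟩) le_rfl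
          (by positivity) using 2
        ring)
    refine le_trans (le_of_eq ?_) h
    congr 3
    push_cast
    rw [hμ]; ring
  · have h := abs_zigRise_sub_le (N := N) (m := k + 1) (γ := γ) (v := v₂)
      (a := Ω + (k + 2) * μ / 2 - 2 * (N + 1) * v₁) (μ := -μ) hγ h₂ hδ hδ' b₂
      (by push_cast; linarith)
      (fun i hi => by
        have hi' : (i : ℝ) ≤ k + 1 := by exact_mod_cast hi
        have hi0 : (0 : ℝ) ≤ i := Nat.cast_nonneg i
        convert key ((k + 2) / 2 - i) (2 * (N + 1) * v₁) (abs_le.mpr ⟨by linarith, by linarith⟩)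
          hz₁ (by linarith) using 2
        ring)
    refine le_trans (le_of_eq ?_) h
    congr 3
    push_cast
    rw [hμ]; ring
  · have h := abs_zigRise_sub_le (N := N) (m := k) (γ := γ) (v := v₁)
      (a := Ω - k * μ / 2 - 2 * (N + 1) * (v₁ + v₂)) (μ := μ) hγ h₁ hδ hδ' b₁
      (by linarith)
      (fun i hi => by
        have hi' : (i : ℝ) ≤ k := by exact_mod_cast hi
        have hi0 : (0 : ℝ) ≤ i := Nat.cast_nonneg i
        convert key (i - k / 2) (2 * (N + 1) * (v₁ + v₂))
          (abs_le.mpr ⟨by linarith, by linarith⟩) (by linarith) hv using 2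
        ring)
    refine le_trans (le_of_eq ?_) h
    congr 3
    rw [hμ]; ring
  · have h := abs_zigRise_sub_le (N := N) (m := k + 1) (γ := γ) (v := v₂)
      (a := Ω + k * μ / 2 - 2 * (N + 1) * v₂) (μ := -μ) hγ h₂ hδ hδ' b₂
      (by push_cast; linarith)
      (fun i hi => by
        have hi' : (i : ℝ) ≤ k + 1 := by exact_mod_cast hi
        convert key (k / 2 - i) (2 * (N + 1) * v₂) (abs_le.mpr ⟨by linarith, by linarith⟩)
          hz₂ (by linarith) using 2
        ring)
    refine le_trans (le_of_eq ?_) h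
    congr 3
    push_cast
    rw [hμ]; ring

/-- The excess over `γ` of the mean slope for which the first order expansions of the four gains in
height add up to zero. -/
noncomputable def meanSlope (N k : ℕ) (t S : ℝ) : ℝ := ((k + 1) * (N + 2) * S - t) / (2 * k + 3)

/-- For a suitable mean slope `γ + Ω` the four gains in height add up to zero, and each of them is
as predicted by the first order expansions at `γ + meanSlope N k t (v₁ + v₂)`. -/
theorem exists_slope {N k : ℕ} {γ v₁ v₂ μ δ t : ℝ} (hγ : 2 * (N + 1) * γ = Real.pi)
    (h₁ : 0 ≤ v₁) (h₂ : 0 ≤ v₂) (hk : 1 ≤ k) (hkδ : k * δ = 1) (hδ : 0 < δ) (hδ' : 200 * δ ≤ 1)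
    (hv : 2 * (N + 1) * (v₁ + v₂) ≤ δ ^ 2) (hμ : μ = 2 * N * (v₁ - v₂))
    (ht : Real.sin γ = Real.cos γ * t) (ht₀ : 0 ≤ t) (ht₁ : t ≤ 1) (hc : 3 / 4 ≤ Real.cos γ) :
    ∃ Ω D₁ D₂ D₃ D₄ : ℝ,
      |Ω - meanSlope N k t (v₁ + v₂)| ≤ 200 * δ ^ 3 ∧ D₁ + D₂ + D₃ + D₄ = 0 ∧
      D₁ = zigRise N (γ + v₁) (γ + (Ω - (k + 2) * μ / 2)) μ (k + 2) ∧
      D₂ = zigRise N (γ + v₂) (γ + (Ω + (k + 2) * μ / 2 - 2 * (N + 1) * v₁)) (-μ) (k + 1) ∧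
      D₃ = zigRise N (γ + v₁) (γ + (Ω - k * μ / 2 - 2 * (N + 1) * (v₁ + v₂))) μ k ∧
      D₄ = zigRise N (γ + v₂) (γ + (Ω + k * μ / 2 - 2 * (N + 1) * v₂)) (-μ) (k + 1) ∧
      |D₁ - Real.cos γ * (2 * meanSlope N k t (v₁ + v₂) +
        ((k + 1) * (N + 2) + (k + 2) * N) * (v₁ + v₂))| ≤ 1700 * δ ^ 2 ∧
      |D₂ - Real.cos γ * (-2 * k * (v₁ - v₂) - (N + 4) * v₁ + (2 - N) * v₂)| ≤ 1700 * δ ^ 2 ∧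
      |D₃ - Real.cos γ * (-2 * meanSlope N k t (v₁ + v₂) - (2 * (N + 1) * k + N) * (v₁ + v₂))|
        ≤ 1700 * δ ^ 2 := by
  have hk' : (1 : ℝ) ≤ k := by exact_mod_cast hk
  have hc1 := Real.cos_le_one γ
  set c := Real.cos γ with hcdef
  set S := v₁ + v₂ with hS
  set Ω₀ := meanSlope N k t S with hΩ₀
  have hdef : (2 * k + 3) * Ω₀ = (k + 1) * (N + 2) * S - t := by
    rw [hΩ₀, meanSlope]; field_simp
  have hΩ₀le : |Ω₀| ≤ δ := by
    have h3 : (N + 2) * S ≤ δ ^ 2 := by nlinarith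
    have h7 : |(2 * k + 3) * Ω₀| ≤ (2 * k + 3) * δ := by
      rw [hdef, abs_le]
      constructor <;> nlinarith
    rw [abs_mul, abs_of_pos (by positivity)] at h7
    exact le_of_mul_le_mul_left h7 (by positivity)
  have hη : 200 * δ ^ 3 ≤ δ := by nlinarith
  set F : ℝ → ℝ := fun Ω =>
    zigRise N (γ + v₁) (γ + (Ω - (k + 2) * μ / 2)) μ (k + 2) +
    zigRise N (γ + v₂) (γ + (Ω + (k + 2) * μ / 2 - 2 * (N + 1) * v₁)) (-μ) (k + 1) +
    zigRise N (γ + v₁) (γ + (Ω - k * μ / 2 - 2 * (N + 1) * S)) μ k +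
    zigRise N (γ + v₂) (γ + (Ω + k * μ / 2 - 2 * (N + 1) * v₂)) (-μ) (k + 1) with hF
  have hFc : Continuous F := by
    rw [hF]
    refine ((Continuous.add ?_ ?_).add ?_).add ?_
    · exact (continuous_zigRise N (k + 2) _ μ).comp (by fun_prop)
    · exact (continuous_zigRise N (k + 1) _ (-μ)).comp (by fun_prop)
    · exact (continuous_zigRise N k _ μ).comp (by fun_prop)
    · exact (continuous_zigRise N (k + 1) _ (-μ)).comp (by fun_prop)
  have happ : ∀ Ω : ℝ, |Ω - Ω₀| ≤ 200 * δ ^ 3 → _ := fun Ω hΩ =>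
    abs_zigRises_sub_le hγ h₁ h₂ hk hkδ hδ (by linarith) hv hμ (Ω := Ω)
      (by
        have := abs_add_le (Ω - Ω₀) Ω₀
        rw [sub_add_cancel] at this
        linarith)
  have hFlin : ∀ Ω : ℝ, |Ω - Ω₀| ≤ 200 * δ ^ 3 →
      |F Ω - 4 * c * ((2 * k + 3) * (Ω - Ω₀))| ≤ 1200 * δ ^ 2 := by
    intro Ω hΩ
    obtain ⟨e1, e2, e3, e4⟩ := happ Ω hΩ
    rw [abs_le] at e1 e2 e3 e4 ⊢
    have e : 4 * c * ((2 * k + 3) * (Ω - Ω₀)) =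
        (Real.sin γ + c * ((2 * k + 5) * Ω + (k + 2) * N * S)) +
        (Real.sin γ + c * ((2 * k + 3) * Ω + (3 * k + 4) * N * (v₁ - v₂) -
          2 * (N + 1) * (2 * k + 3) * v₁ + 2 * (k + 1) * N * v₂)) +
        (Real.sin γ + c * ((2 * k + 1) * Ω + k * N * S - 2 * (N + 1) * (2 * k + 1) * S)) +
        (Real.sin γ + c * ((2 * k + 3) * Ω - (k + 2) * N * (v₁ - v₂) -
          2 * (N + 1) * (2 * k + 3) * v₂ + 2 * (k + 1) * N * v₂)) := by
      rw [ht]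
      linear_combination (-4 * c) * hdef
    rw [e]
    simp only [hF]
    constructor <;> linarith
  have hbig : 1200 * δ ^ 2 ≤ 4 * c * ((2 * k + 3) * (200 * δ ^ 3)) := by
    have : 4 * c * ((2 * k + 3) * (200 * δ ^ 3))
        = 1600 * c * (k * δ) * δ ^ 2 + 2400 * c * δ ^ 3 := by ring
    rw [this, hkδ]
    have : 0 ≤ δ ^ 3 := by positivity
    nlinarith [sq_nonneg δ]
  have hη0 : 0 ≤ 200 * δ ^ 3 := by positivity
  obtain ⟨Ω, hΩ, hΩ0⟩ : ∃ Ω ∈ Set.Icc (Ω₀ - 200 * δ ^ 3) (Ω₀ + 200 * δ ^ 3), F Ω = 0 := by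
    have hlo := hFlin (Ω₀ - 200 * δ ^ 3) (by
      rw [sub_sub_cancel_left, abs_neg, abs_of_nonneg hη0])
    have hhi := hFlin (Ω₀ + 200 * δ ^ 3) (by rw [add_sub_cancel_left, abs_of_nonneg hη0])
    rw [abs_le] at hlo hhi
    refine intermediate_value_Icc (by linarith) hFc.continuousOn ⟨?_, ?_⟩
    · rw [sub_sub_cancel_left] at hlo
      linarith
    · rw [add_sub_cancel_left] at hhi
      linarith
  have hΩ' : |Ω - Ω₀| ≤ 200 * δ ^ 3 := abs_le.mpr ⟨by linarith [hΩ.1], by linarith [hΩ.2]⟩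
  obtain ⟨e1, e2, e3, -⟩ := happ Ω hΩ'
  have hmul : ∀ q : ℝ, 0 ≤ q → q ≤ 7 * k → |c * (q * (Ω - Ω₀))| ≤ 1400 * δ ^ 2 := by
    intro q hq0 hq
    rw [abs_mul, abs_mul, abs_of_nonneg hq0, abs_of_nonneg (by linarith : (0 : ℝ) ≤ c)]
    calc c * (q * |Ω - Ω₀|) ≤ 1 * (7 * k * (200 * δ ^ 3)) := by gcongr
      _ = 1400 * (k * δ) * δ ^ 2 := by ring
      _ = _ := by rw [hkδ]; ring
  refine ⟨Ω, _, _, _, _, hΩ', hΩ0, rfl, rfl, rfl, rfl, ?_, ?_, ?_⟩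
  · have h3 := hmul (2 * k + 5) (by positivity) (by linarith)
    rw [abs_le] at h3 e1 ⊢
    have e : c * (2 * Ω₀ + ((k + 1) * (N + 2) + (k + 2) * N) * S) + c * ((2 * k + 5) * (Ω - Ω₀))
        = Real.sin γ + c * ((2 * k + 5) * Ω + (k + 2) * N * S) := by
      rw [ht]
      linear_combination (-c) * hdef
    constructor <;> linarith
  · have h3 := hmul (2 * k + 3) (by positivity) (by linarith)
    rw [abs_le] at h3 e2 ⊢
    have e : c * (-2 * k * (v₁ - v₂) - (N + 4) * v₁ + (2 - N) * v₂) +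
        c * ((2 * k + 3) * (Ω - Ω₀))
        = Real.sin γ + c * ((2 * k + 3) * Ω + (3 * k + 4) * N * (v₁ - v₂) -
          2 * (N + 1) * (2 * k + 3) * v₁ + 2 * (k + 1) * N * v₂) := by
      rw [ht]
      linear_combination (-c) * hdef
    constructor <;> linarith
  · have h3 := hmul (2 * k + 1) (by positivity) (by linarith)
    rw [abs_le] at h3 e3 ⊢
    have e : c * (-2 * Ω₀ - (2 * (N + 1) * k + N) * S) + c * ((2 * k + 1) * (Ω - Ω₀))
        = Real.sin γ + c * ((2 * k + 1) * Ω + k * N * S - 2 * (N + 1) * (2 * k + 1) * S) := by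
      rw [ht]
      linear_combination (-c) * hdef
    constructor <;> linarith

/-! ### The range of parameters in which a tile word is realized -/

theorem leg_sin_lower {l e g δ : ℝ} (hl : 1 / 2 ≤ l) (hδ : 0 < δ) (hδ' : 200 * δ ≤ 1)
    (he₀ : 0 ≤ e) (he : e ≤ 5 * δ) (hg : g - 5 * δ ^ 2 ≤ e) :
    g / 2 - 13 * δ ^ 2 ≤ l * Real.sin e := by
  have h1 := Real.sin_ge_sub_cube he₀
  have h2 : e ^ 3 ≤ (5 * δ) ^ 3 := by gcongr
  have h3 : 0 ≤ Real.sin e := Real.sin_nonneg_of_nonneg_of_le_pi he₀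
    (by linarith [Real.pi_gt_three])
  nlinarith [sq_nonneg δ]

theorem half_le_legTwo {γ v₁ v₂ : ℝ} (hγ : 0 < γ) (h₁ : 0 ≤ v₁) (h₂ : 0 ≤ v₂)
    (hπ : γ + v₂ ≤ Real.pi / 2) (hs : 0 < Real.sin (γ + v₁ + (γ + v₂)))
    (hv : v₁ + v₂ ≤ Real.sin γ * (1 - Real.cos γ)) :
    1 / 2 ≤ legTwo (γ + v₁) (γ + v₂) := by
  rw [legTwo, le_div_iff₀ hs]
  have h3 : Real.sin γ ≤ Real.sin (γ + v₂) :=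
    Real.sin_le_sin_of_le_of_le_pi_div_two (by linarith [Real.pi_pos]) hπ (by linarith)
  have h4 := Real.abs_sin_sub_sin_le (γ + v₁ + (γ + v₂)) (2 * γ)
  rw [show γ + v₁ + (γ + v₂) - 2 * γ = v₁ + v₂ by ring, abs_of_nonneg (add_nonneg h₁ h₂),
    Real.sin_two_mul] at h4
  have h5 := (abs_le.mp h4).2
  nlinarith

/-- The parameter regime in which the word `tileWord (N + 1) k` is used. The base angles exceed
`γ = π / (2 * (N + 1))` by `v₁` and `v₂`; here `δ = 1 / k`, the number `2 * (N + 1) ^ 2 * m` is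
`tan γ`, and `v₁ + v₂` equals `N * m * δ ^ 2` up to third order terms. -/
structure Regime (N k : ℕ) (m v₁ v₂ δ : ℝ) : Prop where
  two_le : 2 ≤ N
  v₁_nonneg : 0 ≤ v₁
  v₂_nonneg : 0 ≤ v₂
  one_le : 1 ≤ k
  mul_eq_one : k * δ = 1
  δ_pos : 0 < δ
  m_pos : 0 < m
  m_le : 2 * (N + 1) ^ 2 * m ≤ 1
  le_sum : N * m * (δ ^ 2 - 2 * δ ^ 3) ≤ v₁ + v₂
  sum_le : v₁ + v₂ ≤ N * m * δ ^ 2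
  δ_small : 20000 * δ ≤ m

namespace Regime

variable {N k : ℕ} {m v₁ v₂ δ : ℝ}

theorem two_le_cast (h : Regime N k m v₁ v₂ δ) : (2 : ℝ) ≤ N := by exact_mod_cast h.two_le

theorem sum_nonneg (h : Regime N k m v₁ v₂ δ) : 0 ≤ v₁ + v₂ :=
  add_nonneg h.v₁_nonneg h.v₂_nonneg

theorem mul_m_le (h : Regime N k m v₁ v₂ δ) : 2 * (N + 1) * (N * m) ≤ 1 := by
  have h1 := h.m_le
  have h2 : 0 ≤ (N + 1) * m := mul_nonneg (by positivity) h.m_pos.le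
  linarith

theorem δ_le (h : Regime N k m v₁ v₂ δ) : 200 * δ ≤ 1 := by
  have h1 := h.m_le
  have h2 := h.δ_small
  have h3 : 0 ≤ ((N : ℝ) ^ 2 + 2 * N) * m := mul_nonneg (by positivity) h.m_pos.le
  linarith

theorem mul_sum_le (h : Regime N k m v₁ v₂ δ) : 2 * (N + 1) * (v₁ + v₂) ≤ δ ^ 2 := by
  calc 2 * (N + 1) * (v₁ + v₂) ≤ 2 * (N + 1) * (N * m * δ ^ 2) := by gcongr; exact h.sum_le
    _ = 2 * (N + 1) * (N * m) * δ ^ 2 := by ring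
    _ ≤ 1 * δ ^ 2 := by gcongr; exact h.mul_m_le
    _ = _ := one_mul _

theorem N_mul_nonneg (h : Regime N k m v₁ v₂ δ) : 0 ≤ N * v₁ ∧ 0 ≤ N * v₂ :=
  ⟨mul_nonneg (Nat.cast_nonneg N) h.v₁_nonneg, mul_nonneg (Nat.cast_nonneg N) h.v₂_nonneg⟩

theorem abs_mu_le (h : Regime N k m v₁ v₂ δ) : |2 * N * (v₁ - v₂)| ≤ δ ^ 2 := by
  obtain ⟨n1, n2⟩ := h.N_mul_nonneg
  have h1 := h.mul_sum_le
  have h2 := h.v₁_nonneg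
  have h3 := h.v₂_nonneg
  rw [abs_le]
  constructor <;> linarith

theorem k_mul_sum_le (h : Regime N k m v₁ v₂ δ) : k * (v₁ + v₂) ≤ N * m * δ := by
  calc k * (v₁ + v₂) ≤ k * (N * m * δ ^ 2) := by gcongr; exact h.sum_le
    _ = N * m * δ * (k * δ) := by ring
    _ = _ := by rw [h.mul_eq_one, mul_one]

theorem le_k_mul_sum (h : Regime N k m v₁ v₂ δ) : N * m * (δ - 2 * δ ^ 2) ≤ k * (v₁ + v₂) := by
  calc N * m * (δ - 2 * δ ^ 2) = k * (N * m * (δ ^ 2 - 2 * δ ^ 3)) := by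
        linear_combination (-N * m * (δ - 2 * δ ^ 2)) * h.mul_eq_one
    _ ≤ _ := by gcongr; exact h.le_sum

theorem abs_diff_le (h : Regime N k m v₁ v₂ δ) : |k * (v₁ - v₂)| ≤ N * m * δ := by
  refine le_trans ?_ h.k_mul_sum_le
  rw [abs_mul, Nat.abs_cast]
  have h2 := h.v₁_nonneg
  have h3 := h.v₂_nonneg
  gcongr
  rw [abs_le]
  constructor <;> linarith

/-- To first order the excess of the mean slope is `-tan γ / (2 * k)`. -/
theorem meanSlope_bounds (h : Regime N k m v₁ v₂ δ) :
    0 ≤ 2 * meanSlope N k (2 * (N + 1) ^ 2 * m) (v₁ + v₂) + 2 * (N + 1) ^ 2 * m * δ ∧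
    2 * meanSlope N k (2 * (N + 1) ^ 2 * m) (v₁ + v₂) + 2 * (N + 1) ^ 2 * m * δ ≤ 3 * δ ^ 2 := by
  have hS0 := h.sum_nonneg
  have hnS := h.mul_sum_le
  have hkδ := h.mul_eq_one
  have hδ := h.δ_pos
  have hm := h.m_pos
  have ht₁ := h.m_le
  have hN0 : 0 ≤ N * (v₁ + v₂) := mul_nonneg (Nat.cast_nonneg N) hS0
  generalize v₁ + v₂ = S at *
  have ht : 0 < 2 * ((N : ℝ) + 1) ^ 2 * m := by positivity
  generalize 2 * ((N : ℝ) + 1) ^ 2 * m = t at *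
  have hdef : (2 * k + 3) * meanSlope N k t S = (k + 1) * (N + 2) * S - t := by
    rw [meanSlope]; field_simp
  generalize meanSlope N k t S = Ω₀ at *
  have e : (2 * k + 3) * (2 * Ω₀ + t * δ) = 2 * ((k + 1) * (N + 2) * S) + 3 * (t * δ) := by
    linear_combination 2 * hdef + 2 * t * hkδ
  have hk3 : (0 : ℝ) < 2 * k + 3 := by linarith
  constructor
  · have h3 : 0 ≤ (2 * k + 3) * (2 * Ω₀ + t * δ) := by rw [e]; positivity
    exact nonneg_of_mul_nonneg_right h3 hk3
  · have h3 : (N + 2) * S ≤ δ ^ 2 := by linarith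
    have h4 : (k + 1) * ((N + 2) * S) ≤ (k + 1) * δ ^ 2 := by gcongr
    have h6 : t * δ ≤ 1 * δ := by gcongr
    have h8 : (2 * (k : ℝ) + 3) * (3 * δ ^ 2) = 6 * δ + 9 * δ ^ 2 := by
      linear_combination 6 * δ * hkδ
    have h7 : (2 * k + 3) * (2 * Ω₀ + t * δ) ≤ (2 * k + 3) * (3 * δ ^ 2) := by
      rw [e, h8]
      linarith
    exact le_of_mul_le_mul_left h7 hk3

/-- First order values of the gains in height along the first three zigzags. They do not depend on
`meanSlope` any more, because `k * (v₁ + v₂)` is `N * m * δ` up to second order terms. -/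
theorem first_order (h : Regime N k m v₁ v₂ δ) :
    |(2 * meanSlope N k (2 * (N + 1) ^ 2 * m) (v₁ + v₂) +
      ((k + 1) * (N + 2) + (k + 2) * N) * (v₁ + v₂)) + 2 * (N + 1) * m * δ| ≤ 5 * δ ^ 2 ∧
    |(-2 * k * (v₁ - v₂) - (N + 4) * v₁ + (2 - N) * v₂) + 2 * (k * (v₁ - v₂))| ≤ 2 * δ ^ 2 ∧
    |(-2 * meanSlope N k (2 * (N + 1) ^ 2 * m) (v₁ + v₂) - (2 * (N + 1) * k + N) * (v₁ + v₂)) +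
      -(2 * (N + 1) * m * δ)| ≤ 5 * δ ^ 2 := by
  obtain ⟨hlo, hhi⟩ := h.meanSlope_bounds
  obtain ⟨n1, n2⟩ := h.N_mul_nonneg
  have hnS := h.mul_sum_le
  have hv₁ := h.v₁_nonneg
  have hv₂ := h.v₂_nonneg
  have h3 : -(2 * δ ^ 2) ≤ 2 * (N + 1) * (k * (v₁ + v₂) - N * m * δ) := by
    have h1 : 2 * (N + 1) * (N * m * (δ - 2 * δ ^ 2)) ≤ 2 * (N + 1) * (k * (v₁ + v₂)) :=
      mul_le_mul_of_nonneg_left h.le_k_mul_sum (by positivity)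
    have h2 : 2 * (N + 1) * (N * m) * δ ^ 2 ≤ 1 * δ ^ 2 := by
      gcongr
      exact h.mul_m_le
    linarith
  have h4 : 2 * (N + 1) * (k * (v₁ + v₂) - N * m * δ) ≤ 0 :=
    mul_nonpos_of_nonneg_of_nonpos (by positivity) (by linarith [h.k_mul_sum_le])
  refine ⟨?_, ?_, ?_⟩
  · rw [abs_le]
    constructor <;> linarith
  · rw [abs_le]
    constructor <;> linarith
  · rw [abs_le]
    constructor <;> linarith

/-- If the first critical vertex has the height `c * ((N + 1) * m * δ + r)`, where
`r = k * (v₁ - v₂)`, then to first order the third one lies symmetrically to it about the line of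
flight, and so do the second and the fourth, with `-r` in place of `r`. -/
theorem heights (h : Regime N k m v₁ v₂ δ) {c D₁ D₂ D₃ : ℝ} (hc₀ : 0 ≤ c) (hc₁ : c ≤ 1)
    (b₁ : |D₁ - c * (2 * meanSlope N k (2 * (N + 1) ^ 2 * m) (v₁ + v₂) +
      ((k + 1) * (N + 2) + (k + 2) * N) * (v₁ + v₂))| ≤ 1700 * δ ^ 2)
    (b₂ : |D₂ - c * (-2 * k * (v₁ - v₂) - (N + 4) * v₁ + (2 - N) * v₂)| ≤ 1700 * δ ^ 2)
    (b₃ : |D₃ - c * (-2 * meanSlope N k (2 * (N + 1) ^ 2 * m) (v₁ + v₂) -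
      (2 * (N + 1) * k + N) * (v₁ + v₂))| ≤ 1700 * δ ^ 2) :
    |c * ((N + 1) * m * δ + k * (v₁ - v₂)) + D₁ + c * ((N + 1) * m * δ + -(k * (v₁ - v₂)))|
      ≤ 6000 * δ ^ 2 ∧
    |c * ((N + 1) * m * δ + k * (v₁ - v₂)) + D₁ + D₂ + c * ((N + 1) * m * δ + k * (v₁ - v₂))|
      ≤ 6000 * δ ^ 2 ∧
    |c * ((N + 1) * m * δ + k * (v₁ - v₂)) + D₁ + D₂ + D₃ -
      c * ((N + 1) * m * δ + -(k * (v₁ - v₂)))| ≤ 6000 * δ ^ 2 := by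
  obtain ⟨a₁, a₂, a₃⟩ := h.first_order
  have close : ∀ {D L T C : ℝ}, |D - c * L| ≤ 1700 * δ ^ 2 → |L + T| ≤ C → |D + c * T| ≤
      1700 * δ ^ 2 + C := by
    intro D L T C hD hL
    have e : D + c * T = (D - c * L) + c * (L + T) := by ring
    rw [e]
    refine (abs_add_le _ _).trans (add_le_add hD ?_)
    rw [abs_mul, abs_of_nonneg hc₀]
    exact (mul_le_of_le_one_left (abs_nonneg _) hc₁).trans hL
  have d₁ := abs_le.mp (close b₁ a₁)
  have d₂ := abs_le.mp (close b₂ a₂)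
  have d₃ := abs_le.mp (close b₃ a₃)
  refine ⟨?_, ?_, ?_⟩ <;> rw [abs_le] <;> constructor <;> linarith

theorem sq_le (h : Regime N k m v₁ v₂ δ) : 20000 * δ ^ 2 ≤ m * δ := by
  have := mul_le_mul_of_nonneg_right h.δ_small h.δ_pos.le
  linarith

theorem pos_height (h : Regime N k m v₁ v₂ δ) {c s : ℝ} (hc : 3 / 4 ≤ c)
    (hs : |s| ≤ N * m * δ) : 6000 * δ ^ 2 < c * ((N + 1) * m * δ + s) := by
  have h1 := (abs_le.mp hs).1
  have h2 : m * δ ≤ (N + 1) * m * δ + s := by linarith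
  have h3 := h.sq_le
  have h4 : 0 < m * δ := mul_pos h.m_pos h.δ_pos
  have h5 : 3 / 4 * (m * δ) ≤ c * ((N + 1) * m * δ + s) := by gcongr
  linarith

theorem height_le (h : Regime N k m v₁ v₂ δ) {c s : ℝ} (hc₁ : c ≤ 1)
    (hs : |s| ≤ N * m * δ) : c * ((N + 1) * m * δ + s) ≤ (N + 1) * m * δ + s := by
  have h1 := (abs_le.mp hs).1
  have h4 : 0 < m * δ := mul_pos h.m_pos h.δ_pos
  exact mul_le_of_le_one_left (by linarith) hc₁

/-- The expression on the right is the first order value of the angle between the line of flight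
and the short side issuing from a critical vertex. -/
theorem le_angle (h : Regime N k m v₁ v₂ δ) {s : ℝ} (hs : |s| ≤ N * m * δ) :
    m * δ ≤ (N + 1) ^ 2 * m * δ + N * s := by
  have h1 := (abs_le.mp hs).1
  have h3 : N * (-(N * m * δ)) ≤ N * s := by gcongr
  have h4 : 0 < m * δ := mul_pos h.m_pos h.δ_pos
  have h5 : 0 ≤ N * (m * δ) := by positivity
  linarith

/-- To first order, half the angle between the line of flight and the short side issuing from a
critical vertex exceeds the distance of this vertex from the line. -/
theorem lt_half_angle (h : Regime N k m v₁ v₂ δ) {s : ℝ} (hs : |s| ≤ N * m * δ) :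
    (N + 1) * m * δ + s + 6000 * δ ^ 2 < ((N + 1) ^ 2 * m * δ + N * s) / 2 - 13 * δ ^ 2 := by
  have h1 := (abs_le.mp hs).1
  have h3 : (N - 2) * (-(N * m * δ)) ≤ (N - 2) * s :=
    mul_le_mul_of_nonneg_left h1 (by linarith [h.two_le_cast])
  have h4 : 0 < m * δ := mul_pos h.m_pos h.δ_pos
  have h5 : 2 * (m * δ) ≤ N * (m * δ) := by gcongr; exact h.two_le_cast
  have h6 := h.sq_le
  linarith

/-- All slopes of ascending sides lie slightly below the slope `γ` of the regular case. -/
theorem slope_mem (h : Regime N k m v₁ v₂ δ) {γ Ω θ z : ℝ} (hδγ : 15 * δ ≤ γ)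
    (hΩ : |Ω - meanSlope N k (2 * (N + 1) ^ 2 * m) (v₁ + v₂)| ≤ 200 * δ ^ 3)
    (hθ : |θ| ≤ (k + 2) / 2) (hz : 0 ≤ z) (hz' : z ≤ δ ^ 2) :
    γ + (Ω + θ * (2 * N * (v₁ - v₂)) - z) ∈
      Set.Icc (2 * γ / 3) (γ - 2 * (N + 1) * (v₁ + v₂)) := by
  obtain ⟨hlo, hhi⟩ := h.meanSlope_bounds
  have hm1 : 2 * (N + 1) ^ 2 * m * δ ≤ 1 * δ := by
    gcongr
    · exact h.δ_pos.le
    · exact h.m_le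
  have hΩ' := abs_le.mp hΩ
  have hδ2 : 200 * δ * δ ≤ 1 * δ := by
    gcongr
    · exact h.δ_pos.le
    · exact h.δ_le
  have hδ3 : 200 * δ * δ ^ 2 ≤ 1 * δ ^ 2 := by
    gcongr
    exact h.δ_le
  have hδ := h.δ_pos
  have hm0 : 0 ≤ 2 * (N + 1) ^ 2 * m * δ := by
    have := h.m_pos
    positivity
  have hΩ2 : |Ω| ≤ 2 * δ := by
    rw [abs_le]; constructor <;> linarith
  have h3 := (abs_le.mp (abs_slope_le h.one_le h.mul_eq_one hδ hΩ2 h.abs_mu_le hθ hz hz')).1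
  have h4 : θ * (2 * N * (v₁ - v₂)) ≤ N * |k * (v₁ - v₂)| + δ ^ 2 := by
    calc θ * (2 * N * (v₁ - v₂)) ≤ |θ * (2 * N * (v₁ - v₂))| := le_abs_self _
      _ = |θ| * |2 * N * (v₁ - v₂)| := abs_mul _ _
      _ ≤ (k + 2) / 2 * |2 * N * (v₁ - v₂)| := by gcongr
      _ = N * |k * (v₁ - v₂)| + |2 * N * (v₁ - v₂)| := by
        simp only [abs_mul, Nat.abs_cast, abs_two]; ring
      _ ≤ _ := by gcongr; exact h.abs_mu_le
  have h5 := h.le_angle (s := -|k * (v₁ - v₂)|) (by rw [abs_neg, abs_abs]; exact h.abs_diff_le)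
  have h6 := h.sq_le
  have h7 := h.mul_sum_le
  constructor <;> linarith

theorem slopeRange (h : Regime N k m v₁ v₂ δ) {γ : ℝ} (hγ : 2 * (N + 1) * γ = Real.pi)
    (hδγ : 15 * δ ≤ γ) :
    SlopeRange N (γ + v₁) (γ + v₂) (2 * γ / 3) (γ - 2 * (N + 1) * (v₁ + v₂)) := by
  obtain ⟨n1, n2⟩ := h.N_mul_nonneg
  have hS := h.mul_sum_le
  have hδ2 : 200 * δ * δ ≤ 1 * δ := by
    gcongr
    · exact h.δ_pos.le
    · exact h.δ_le
  have hδ := h.δ_pos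
  have hNγ : 2 * γ ≤ N * γ := by
    gcongr
    · linarith
    · exact h.two_le_cast
  constructor <;> nlinarith

/-- The short side issuing from a critical vertex, which has a length `l ≥ 1 / 2`, crosses the
line of flight. -/
theorem height_lt (h : Regime N k m v₁ v₂ δ) {l e s : ℝ} (hl : 1 / 2 ≤ l)
    (hs : |s| ≤ N * m * δ) (he : e ≤ 5 * δ) (he' : (N + 1) ^ 2 * m * δ + N * s - 5 * δ ^ 2 ≤ e) :
    (N + 1) * m * δ + s + 6000 * δ ^ 2 < l * Real.sin e :=
  (h.lt_half_angle hs).trans_le (leg_sin_lower hl h.δ_pos h.δ_le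
    (by linarith [h.le_angle hs, h.sq_le, sq_nonneg δ]) he he')

/-- The first critical vertex is put at the height for which the four of them lie symmetrically
about the line of flight to first order. -/
theorem mem_orbitTile (h : Regime N k m v₁ v₂ δ) {γ : ℝ} (hγ : 2 * (N + 1) * γ = Real.pi)
    {X : Plane} (hX₀ : X 0 = γ + v₁) (hX₁ : X 1 = γ + v₂)
    (ht : Real.sin γ = Real.cos γ * (2 * (N + 1) ^ 2 * m)) (hc : 3 / 4 ≤ Real.cos γ)
    (hδγ : 15 * δ ≤ γ) (hδs : δ ^ 2 ≤ Real.sin γ * (1 - Real.cos γ)) :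
    X ∈ orbitTile (tileWord (N + 1) k) := by
  have hm := h.m_pos
  obtain ⟨Ω, D₁, D₂, D₃, D₄, hΩ, hD, hD₁, hD₂, hD₃, hD₄, b₁, b₂, b₃⟩ :=
    exists_slope hγ h.v₁_nonneg h.v₂_nonneg h.one_le h.mul_eq_one
      h.δ_pos h.δ_le h.mul_sum_le rfl ht (by positivity) h.m_le hc
  have hc1 := Real.cos_le_one γ
  obtain ⟨hP, hQ, hR⟩ := h.heights (by linarith) hc1 b₁ b₂ b₃
  have hrange := h.slopeRange hγ hδγ
  have hslope := fun (θ z : ℝ) => h.slope_mem (θ := θ) (z := z) hδγ hΩ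
  have hcorner := fun (l e s : ℝ) => h.height_lt (l := l) (e := e) (s := s)
  have hr := h.abs_diff_le
  have hrn : |-(k * (v₁ - v₂))| ≤ N * m * δ := by rwa [abs_neg]
  have p₁ := h.pos_height hc hr
  have p₂ := h.pos_height hc hrn
  have q₁ := h.height_le hc1 hr
  have q₂ := h.height_le hc1 hrn
  have hS := h.mul_sum_le
  have hv₁ := h.v₁_nonneg
  have hv₂ := h.v₂_nonneg
  obtain ⟨n1, n2⟩ := h.N_mul_nonneg
  have hδ := h.δ_pos
  have hδ2 := sq_nonneg δ
  have hδδ : 200 * δ * δ ≤ 1 * δ := by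
    gcongr
    exact h.δ_le
  have hδ3 : 200 * δ * δ ^ 2 ≤ 1 * δ ^ 2 := by
    gcongr
    exact h.δ_le
  have hγ0 : 0 < γ := by linarith
  have hNγ : 2 * γ ≤ N * γ := by gcongr; exact h.two_le_cast
  have hs : 0 < Real.sin (γ + v₁ + (γ + v₂)) :=
    Real.sin_pos_of_pos_of_lt_pi (by linarith) (by linarith)
  have l₂ := half_le_legTwo hγ0 hv₁ hv₂ (by linarith) hs (by linarith)
  have l₁ : 1 / 2 ≤ legOne (γ + v₁) (γ + v₂) := by
    rw [← legTwo_swap]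
    exact half_le_legTwo hγ0 hv₂ hv₁ (by linarith) (by rwa [add_comm]) (by linarith)
  have hX : X ∈ paramSpace := by
    refine ⟨?_, ?_, ?_⟩
    · rw [hX₀]; linarith
    · rw [hX₁]; linarith
    · rw [hX₀, hX₁]; linarith
  obtain ⟨hlo, hhi⟩ := h.meanSlope_bounds
  have hm1 : 2 * (N + 1) ^ 2 * m * δ ≤ 1 * δ := by
    gcongr
    exact h.m_le
  have hΩ' := abs_le.mp hΩ
  have hNr : |N * (k * (v₁ - v₂))| ≤ 1 / 2 * δ := by
    rw [abs_mul, Nat.abs_cast]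
    calc N * |k * (v₁ - v₂)| ≤ (N + 1) * (N * m * δ) := by
          gcongr
          linarith
      _ = (2 * (N + 1) * (N * m)) * δ / 2 := by ring
      _ ≤ 1 * δ / 2 := by gcongr; exact h.mul_m_le
      _ = _ := by ring
  have hNr' := abs_le.mp hNr
  rw [abs_le] at hP hQ hR
  clear b₁ b₂ b₃ hNr hr
  refine mem_orbitTile_of_zigRise (by linarith [h.two_le]) hX hX₀ hX₁
    (μ := 2 * N * (v₁ - v₂)) (by ring) hrange
    (u₀ := γ + (Ω - (k + 2) * (2 * N * (v₁ - v₂)) / 2))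
    (u₁ := γ + (Ω + (k + 2) * (2 * N * (v₁ - v₂)) / 2 - 2 * (N + 1) * v₁))
    (u₂ := γ + (Ω - k * (2 * N * (v₁ - v₂)) / 2 - 2 * (N + 1) * (v₁ + v₂)))
    (u₃ := γ + (Ω + k * (2 * N * (v₁ - v₂)) / 2 - 2 * (N + 1) * v₂))
    (O := Real.cos γ * ((N + 1) * m * δ + k * (v₁ - v₂)))
    (by linear_combination hγ) (by linear_combination hγ) (by linear_combination -hγ)
    ?_ ?_ ?_ ?_ (by rw [← hD₁]) (by rw [← hD₂]) (by rw [← hD₃]) (by rw [← hD₄]; linarith)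
    (by linarith) (by linarith) (by linarith) (by linarith) ?_ ?_ ?_ ?_
  · intro i hi
    have hi' : (i : ℝ) ≤ k + 2 := by exact_mod_cast hi
    have hi0 : (0 : ℝ) ≤ i := Nat.cast_nonneg i
    convert hslope (i - (k + 2) / 2) 0 (abs_le.mpr ⟨by linarith, by linarith⟩) le_rfl hδ2 using 1
    ring
  · intro i hi
    have hi' : (i : ℝ) ≤ k + 1 := by exact_mod_cast hi
    have hi0 : (0 : ℝ) ≤ i := Nat.cast_nonneg i
    convert hslope ((k + 2) / 2 - i) (2 * (N + 1) * v₁) (abs_le.mpr ⟨by linarith, by linarith⟩)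
      (by positivity) (by linarith) using 1
    ring
  · intro i hi
    have hi' : (i : ℝ) ≤ k := by exact_mod_cast hi
    have hi0 : (0 : ℝ) ≤ i := Nat.cast_nonneg i
    convert hslope (i - k / 2) (2 * (N + 1) * (v₁ + v₂))
      (abs_le.mpr ⟨by linarith, by linarith⟩) (by positivity) hS using 1
    ring
  · intro i hi
    have hi' : (i : ℝ) ≤ k + 1 := by exact_mod_cast hi
    convert hslope (k / 2 - i) (2 * (N + 1) * v₂) (abs_le.mpr ⟨by linarith, by linarith⟩)
      (by positivity) (by linarith) using 1
    ring
  · have := hcorner (legTwo (γ + v₁) (γ + v₂))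
      (γ + v₁ - (γ + (Ω - (k + 2) * (2 * N * (v₁ - v₂)) / 2) +
        (k + 2) * (2 * N * (v₁ - v₂)))) _ l₂ hrn (by linarith) (by linarith)
    linarith
  · have := hcorner (legOne (γ + v₁) (γ + v₂))
      (γ + v₂ - (γ + (Ω + (k + 2) * (2 * N * (v₁ - v₂)) / 2 - 2 * (N + 1) * v₁) +
        (k + 1) * -(2 * N * (v₁ - v₂)))) _ l₁ h.abs_diff_le (by linarith) (by linarith)
    linarith
  · have := hcorner (legTwo (γ + v₁) (γ + v₂))
      (γ + v₁ - (γ + (Ω + k * (2 * N * (v₁ - v₂)) / 2 - 2 * (N + 1) * v₂))) _ l₂ hrn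
      (by linarith) (by linarith)
    linarith
  · have := hcorner (legOne (γ + v₁) (γ + v₂))
      (γ + v₂ - (γ + (Ω - (k + 2) * (2 * N * (v₁ - v₂)) / 2))) _ l₁ h.abs_diff_le
      (by linarith) (by linarith)
    linarith

end Regime

/-! ### A neighbourhood of the Veech point -/

/-- The number `k` is the integer part of `√(a / S)`; this makes `S` equal to `a / k ^ 2` up to
third order terms in `1 / k`. -/
theorem exists_repetition {a S : ℝ} {K : ℕ} (hK : 1 ≤ K) (hS : 0 < S) (ha : 0 ≤ a)
    (hSK : S * K ^ 2 ≤ a) :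
    ∃ k : ℕ, K ≤ k ∧ a * ((1 / k) ^ 2 - 2 * (1 / k) ^ 3) ≤ S ∧ S ≤ a * (1 / k : ℝ) ^ 2 := by
  have hsq : Real.sqrt (a / S) ^ 2 = a / S := Real.sq_sqrt (by positivity)
  set x := Real.sqrt (a / S) with hx
  have hx0 : 0 ≤ x := Real.sqrt_nonneg _
  have hKx : (K : ℝ) ≤ x := Real.le_sqrt_of_sq_le (by rwa [le_div_iff₀ hS, mul_comm])
  have hKk : K ≤ ⌊x⌋₊ := Nat.le_floor hKx
  have hk1 : (1 : ℝ) ≤ (⌊x⌋₊ : ℝ) := by exact_mod_cast hK.trans hKk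
  have hlo : (⌊x⌋₊ : ℝ) ≤ x := Nat.floor_le hx0
  have hhi : x < ⌊x⌋₊ + 1 := Nat.lt_floor_add_one x
  refine ⟨⌊x⌋₊, hKk, ?_, ?_⟩
  · generalize (⌊x⌋₊ : ℝ) = k at *
    have h1 : a / S ≤ (k + 1) ^ 2 := by rw [← hsq]; gcongr
    rw [div_le_iff₀ hS] at h1
    have e : (k + 1) ^ 2 * ((1 / k) ^ 2 - 2 * (1 / k) ^ 3)
        = 1 - 3 * (1 / k) ^ 2 - 2 * (1 / k) ^ 3 := by
      field_simp; ring
    by_cases hneg : (1 / k) ^ 2 - 2 * (1 / k) ^ 3 ≤ 0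
    · exact (mul_nonpos_of_nonneg_of_nonpos ha hneg).trans hS.le
    · calc a * ((1 / k) ^ 2 - 2 * (1 / k) ^ 3)
          ≤ (k + 1) ^ 2 * S * ((1 / k) ^ 2 - 2 * (1 / k) ^ 3) :=
            mul_le_mul_of_nonneg_right h1 (not_le.mp hneg).le
        _ = (1 - 3 * (1 / k) ^ 2 - 2 * (1 / k) ^ 3) * S := by rw [← e]; ring
        _ ≤ 1 * S := by
          gcongr
          have : 0 < (1 / k) ^ 3 := by positivity
          linarith [sq_nonneg (1 / k)]
        _ = S := one_mul S
  · have h1 : (⌊x⌋₊ : ℝ) ^ 2 ≤ a / S := by rw [← hsq]; gcongr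
    rw [le_div_iff₀ hS] at h1
    rw [one_div, inv_pow, ← div_eq_mul_inv, le_div_iff₀ (by positivity)]
    linarith

theorem coord_of_mem_closure_quadrantNhd {n : ℕ} {ε : ℝ} {X : Plane}
    (hX : X ∈ closure (quadrantNhd n ε)) (i : Fin 2) :
    X i ∈ Set.Icc (Real.pi / (2 * n)) (Real.pi / (2 * n) + ε) := by
  have hclosed : IsClosed {X : Plane | X i ∈ Set.Icc (Real.pi / (2 * n))
      (Real.pi / (2 * n) + ε)} :=
    isClosed_Icc.preimage (by fun_prop)
  refine closure_minimal ?_ hclosed hX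
  rintro _ ⟨v, hv, h0, h1, rfl⟩
  have hle : |v i| ≤ ‖v‖ := PiLp.norm_apply_le v i
  rw [mem_ball_zero_iff] at hv
  have hi : 0 < v i := by fin_cases i <;> assumption
  have e : (veechPoint n + v) i = Real.pi / (2 * n) + v i := by
    fin_cases i <;> simp [veechPoint]
  rw [Set.mem_ofPred_eq, e]
  constructor <;> linarith [le_abs_self (v i)]

theorem theorem1p5 (n : ℕ) (hn : 3 ≤ n) :
    ∃ ε : ℝ, 0 < ε ∧
      closure (quadrantNhd n ε) \ {veechPoint n} ⊆ ⋃ k : ℕ, orbitTile (tileWord n k) := by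
  obtain ⟨N, rfl⟩ : ∃ N, n = N + 1 := ⟨n - 1, by omega⟩
  have hN : 2 ≤ N := by omega
  have hN' : (2 : ℝ) ≤ N := by exact_mod_cast hN
  obtain ⟨γ, hγdef⟩ : ∃ γ, γ = Real.pi / (2 * ((N + 1 : ℕ) : ℝ)) := ⟨_, rfl⟩
  have hγ : 2 * (N + 1) * γ = Real.pi := by
    rw [hγdef]; push_cast; field_simp
  have hγ0 : 0 < γ := by rw [hγdef]; positivity
  have hγ6 : γ ≤ Real.pi / 6 := by nlinarith
  have hcos : 3 / 4 ≤ Real.cos γ := by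
    have h1 := Real.cos_le_cos_of_nonneg_of_le_pi hγ0.le (by linarith) hγ6
    rw [Real.cos_pi_div_six] at h1
    have h2 : (3 / 2 : ℝ) ≤ √3 := Real.le_sqrt_of_sq_le (by norm_num)
    linarith
  have hcos1 : Real.cos γ < 1 := by
    have := Real.cos_lt_cos_of_nonneg_of_le_pi le_rfl (by linarith) hγ0
    rwa [Real.cos_zero] at this
  have hsin : 0 < Real.sin γ := Real.sin_pos_of_pos_of_lt_pi hγ0 (by linarith)
  have ht0 : 0 < Real.tan γ := Real.tan_pos_of_pos_of_lt_pi_div_two hγ0 (by linarith)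
  have ht1 : Real.tan γ ≤ 1 := by
    have h1 := Real.sin_le_sin_of_le_of_le_pi_div_two (by linarith) (by linarith) hγ6
    rw [Real.sin_pi_div_six] at h1
    rw [Real.tan_eq_sin_div_cos, div_le_one (by linarith)]
    linarith
  obtain ⟨m, hm⟩ : ∃ m, m = Real.tan γ / (2 * (N + 1) ^ 2) := ⟨_, rfl⟩
  have hm0 : 0 < m := by rw [hm]; positivity
  have htm : 2 * (N + 1) ^ 2 * m = Real.tan γ := by rw [hm]; field_simp
  -- A bound for `1 / k` under which the second order errors are negligible.
  obtain ⟨η, hη0, hη₁, hη₂, hη₃⟩ : ∃ η : ℝ, 0 < η ∧ 20000 * η ≤ m ∧ 15 * η ≤ γ ∧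
      η ≤ Real.sin γ * (1 - Real.cos γ) := by
    refine ⟨min (m / 20000) (min (γ / 15) (Real.sin γ * (1 - Real.cos γ))), by positivity, ?_, ?_,
      (min_le_right _ _).trans (min_le_right _ _)⟩
    · linarith [min_le_left (m / 20000) (min (γ / 15) (Real.sin γ * (1 - Real.cos γ)))]
    · linarith [(min_le_right (m / 20000) (min (γ / 15) (Real.sin γ * (1 - Real.cos γ)))).trans
        (min_le_left _ _)]
  obtain ⟨K, hK⟩ := exists_nat_one_div_lt hη0
  have ha : 0 < N * m := by positivity
  refine ⟨N * m / (2 * (K + 1) ^ 2), by positivity, ?_⟩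
  rintro X ⟨hX, hne⟩
  have h0 := coord_of_mem_closure_quadrantNhd hX 0
  have h1 := coord_of_mem_closure_quadrantNhd hX 1
  rw [← hγdef, Set.mem_Icc] at h0 h1
  have hpos : 0 < (X 0 - γ) + (X 1 - γ) := by
    by_contra hle
    refine hne ?_
    have e0 : X 0 = γ := by linarith [h0.1, h1.1]
    have e1 : X 1 = γ := by linarith [h0.1, h1.1]
    rw [Set.mem_singleton_iff]
    ext i
    fin_cases i
    · simpa [veechPoint, hγdef] using e0
    · simpa [veechPoint, hγdef] using e1
  have hε : N * m / (2 * (K + 1) ^ 2) * (2 * (K + 1) ^ 2) = N * m :=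
    div_mul_cancel₀ _ (by positivity)
  obtain ⟨k, hKk, hlo, hhi⟩ := exists_repetition (K := K + 1) (Nat.le_add_left 1 K) hpos ha.le (by
    push_cast
    have : ((X 0 - γ) + (X 1 - γ)) * ((K : ℝ) + 1) ^ 2 ≤
        (2 * (N * m / (2 * (K + 1) ^ 2))) * (K + 1) ^ 2 := by
      gcongr
      linarith [h0.2, h1.2]
    linarith)
  have hk1 : 1 ≤ k := by omega
  have hk1' : (1 : ℝ) ≤ k := by exact_mod_cast hk1
  have hδ0 : (0 : ℝ) < 1 / k := by positivity
  have hKk' : (K : ℝ) + 1 ≤ k := by exact_mod_cast hKk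
  have hδη : (1 : ℝ) / k ≤ η := (one_div_le_one_div_of_le (by positivity) hKk').trans hK.le
  have hreg : Regime N k m (X 0 - γ) (X 1 - γ) (1 / k) :=
    { two_le := hN
      v₁_nonneg := by linarith [h0.1]
      v₂_nonneg := by linarith [h1.1]
      one_le := hk1
      mul_eq_one := mul_one_div_cancel (by positivity)
      δ_pos := hδ0
      m_pos := hm0
      m_le := htm.trans_le ht1
      le_sum := hlo
      sum_le := hhi
      δ_small := by linarith }
  refine Set.mem_iUnion.mpr ⟨k, hreg.mem_orbitTile hγ (by ring) (by ring) ?_ hcos (by linarith) ?_⟩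
  · rw [htm, mul_comm, Real.tan_mul_cos (by linarith)]
  · nlinarith
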